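/- A parking function of length $n$ is a word $p=(p_1,\dots,p_n)\in[n]^n$ whose weakly increasing rearrangement $p'_1\le\cdots\le p'_n$ satisfies $p'_i\le i$ for all $i$. Let $\pi(p)\in\mathfrak S_n$ be the permutation obtained by listing, for $s=1,2,\dots,n$ in turn, the indices $i$ with $p_i=s$ in increasing order, and let $\mathsf{pf}_n(\sigma)$ be the number of parking functions $p$ of length $n$ such that $\pi(p)$ avoids the pattern $\sigma$. For a composition $\alpha=(\alpha_1,\dots,\alpha_k)\vDash n$ (with positive parts) put \[ d(\alpha)=\det\left[\binom{j-i+\sum_{\ell=1}^i\alpha_\ell}{j-(i-1)}\right],\quad s(\alpha)=\det\left[\binom{j+\sum_{\ell=1}^i\alpha_{k+1-\ell}}{j-(i-1)}\right],\quad s^{\#}(\alpha)=\det\left[\binom{j+\sum_{\ell=1}^i\alpha_\ell}{j-(i-1)}\right], \] where $1\le i,j\le k-1$, a binomial coefficient with negative lower entry is $0$, and an empty determinant is $1$. **Theorem 4.3.** For every $n\ge 0$, \[ \mathsf{pf}_n(132)=\mathsf{pf}_n(231)=\sum_{\alpha\vDash n} d(\alpha)\,s(\alpha),\qquad \mathsf{pf}_n(213)=\mathsf{pf}_n(312)=\sum_{\alpha\vDash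 n} d(\alpha)\,s^{\#}(\alpha). \] Moreover, for every $\alpha=(\alpha_1,\dots,\alpha_k)\vDash n$: - $d(\alpha)$ is the number of Dyck paths with ascent composition $\alpha$, that is, of Dyck paths of the form $U^{\alpha_1}D^{\delta_1}\cdots U^{\alpha_k}D^{\delta_k}$ with all $\delta_i\ge1$; - $s(\alpha)$ is the number of Sylvester classes, and $s^{\#}(\alpha)$ the number of $\#$-Sylvester classes, of words with packed content $\alpha$, that is, of words over $[k]$ in which each letter $i$ occurs exactly $\alpha_i$ times. Here Sylvester equivalence is the equivalence relation on words generated by $u\,ac\,v\,b\,w\equiv u\,ca\,v\,b\,w$ for letters $a\le b<c$, and $\#$-Sylvester equivalence is the one generated by $u\,b\,v\,ac\,w\equiv u\,b\,v\,ca\,w$ for letters $a<b\le c$ (with $u,v,w$ arbitrary words). -/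

import Mathlib

namespace ParkingPattern

/-! Spots, cars and letters are numbered from `0`, so `[n]` is modelled by `Fin n`. -/

/-- `p` is a parking function: its weakly increasing rearrangement `p'` satisfies `p'_i ≤ i`. -/
def IsParkingFunction {n : ℕ} (p : Fin n → Fin n) : Prop :=
  ∀ i : Fin n, p (Tuple.sort p i) ≤ i

/-- The permutation `π(p)` in one-line notation: first the cars preferring spot `1` in increasing
order, then the cars preferring spot `2` in increasing order, and so on. (`Tuple.sort p` lists
the indices `i` in increasing order of the pairs `(p i, i)`, ordered lexicographically.) -/
def labelPerm {n : ℕ} (p : Fin n → Fin n) : Equiv.Perm (Fin n) :=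
  Tuple.sort p

/-- `π` contains the pattern `σ`: there are positions `i_1 < ⋯ < i_k` at which the values of `π`
are in the same relative order as the values of `σ`. -/
def Contains {n k : ℕ} (π : Equiv.Perm (Fin n)) (σ : Equiv.Perm (Fin k)) : Prop :=
  ∃ f : Fin k ↪o Fin n, ∀ a b : Fin k, π (f a) < π (f b) ↔ σ a < σ b

/-- The number of parking functions `p` of length `n` such that `π(p)` avoids `σ`. -/
noncomputable def pf (n : ℕ) {k : ℕ} (σ : Equiv.Perm (Fin k)) : ℕ :=
  Nat.card {p : Fin n → Fin n // IsParkingFunction p ∧ ¬ Contains (labelPerm p) σ}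

/-- The permutation `132` in one-line notation. -/
def perm132 : Equiv.Perm (Fin 3) := ⟨![0, 2, 1], ![0, 2, 1], by decide, by decide⟩

/-- The permutation `213` in one-line notation. -/
def perm213 : Equiv.Perm (Fin 3) := ⟨![1, 0, 2], ![1, 0, 2], by decide, by decide⟩

/-- The permutation `231` in one-line notation. -/
def perm231 : Equiv.Perm (Fin 3) := ⟨![1, 2, 0], ![2, 0, 1], by decide, by decide⟩

/-- The permutation `312` in one-line notation. -/
def perm312 : Equiv.Perm (Fin 3) := ⟨![2, 0, 1], ![1, 2, 0], by decide, by decide⟩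

/-- The binomial coefficient with integer entries, equal to `0` if the lower entry is negative. -/
def binom (a b : ℤ) : ℤ := if 0 ≤ b then Ring.choose a b.toNat else 0

/-- The determinant of the matrix `(M i j)` with indices `1 ≤ i, j ≤ m`. -/
def detFrom1 (m : ℕ) (M : ℕ → ℕ → ℤ) : ℤ :=
  (Matrix.of fun i j : Fin m => M ((i : ℕ) + 1) ((j : ℕ) + 1)).det

/-- `det [ binom (j - i + (α_1 + ⋯ + α_i)) (j - (i - 1)) ]` for `1 ≤ i, j ≤ k - 1`. -/
def dyckDet {n : ℕ} (α : Composition n) : ℤ :=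
  detFrom1 (α.length - 1) fun i j =>
    binom ((j : ℤ) - i + α.sizeUpTo i) ((j : ℤ) - ((i : ℤ) - 1))

/-- `det [ binom (j + (α_k + α_{k-1} + ⋯ + α_{k+1-i})) (j - (i - 1)) ]` for `1 ≤ i, j ≤ k - 1`. -/
def sylvesterDet {n : ℕ} (α : Composition n) : ℤ :=
  detFrom1 (α.length - 1) fun i j =>
    binom ((j : ℤ) + α.reverse.sizeUpTo i) ((j : ℤ) - ((i : ℤ) - 1))

/-- `det [ binom (j + (α_1 + ⋯ + α_i)) (j - (i - 1)) ]` for `1 ≤ i, j ≤ k - 1`. -/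
def sharpSylvesterDet {n : ℕ} (α : Composition n) : ℤ :=
  detFrom1 (α.length - 1) fun i j =>
    binom ((j : ℤ) + α.sizeUpTo i) ((j : ℤ) - ((i : ℤ) - 1))

/-- The Dyck path `D` has ascent composition `α`: it equals
`U^{α_1} D^{δ_1} U^{α_2} D^{δ_2} ⋯ U^{α_k} D^{δ_k}` for some positive `δ_1, …, δ_k`. -/
def HasAscentComposition {n : ℕ} (D : DyckWord) (α : Composition n) : Prop :=
  ∃ δ : Fin α.length → ℕ, (∀ i, 0 < δ i) ∧
    D.toList = (List.ofFn fun i : Fin α.length =>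
      List.replicate (α.blocksFun i) DyckStep.U ++ List.replicate (δ i) DyckStep.D).flatten

/-- The number of Dyck paths with ascent composition `α`. -/
noncomputable def numDyckPaths {n : ℕ} (α : Composition n) : ℕ :=
  Nat.card {D : DyckWord // HasAscentComposition D α}

/-- `w₁ = u ac v b w` and `w₂ = u ca v b w` for words `u, v, w` and letters `a ≤ b < c`. -/
def SylvesterAdj {A : Type*} [LinearOrder A] (w₁ w₂ : List A) : Prop :=
  ∃ (u v w : List A) (a b c : A), a ≤ b ∧ b < c ∧
    w₁ = u ++ [a, c] ++ v ++ [b] ++ w ∧ w₂ = u ++ [c, a] ++ v ++ [b] ++ w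

/-- `w₁ = u b v ac w` and `w₂ = u b v ca w` for words `u, v, w` and letters `a < b ≤ c`. -/
def SharpSylvesterAdj {A : Type*} [LinearOrder A] (w₁ w₂ : List A) : Prop :=
  ∃ (u v w : List A) (a b c : A), a < b ∧ b ≤ c ∧
    w₁ = u ++ [b] ++ v ++ [a, c] ++ w ∧ w₂ = u ++ [b] ++ v ++ [c, a] ++ w

/-- The words over the alphabet `[k]` with packed content `α = (α_1, …, α_k)`, that is, those
in which the letter `i` occurs exactly `α_i` times. -/
def WordsWithContent {n : ℕ} (α : Composition n) : Type :=
  {w : List (Fin α.length) // ∀ i, w.count i = α.blocksFun i}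

/-- The number of Sylvester classes of words with packed content `α`. -/
noncomputable def numSylvesterClasses {n : ℕ} (α : Composition n) : ℕ :=
  Nat.card (Quotient ((Relation.EqvGen.setoid
    (SylvesterAdj (A := Fin α.length))).comap (Subtype.val : WordsWithContent α → _)))

/-- The number of `#`-Sylvester classes of words with packed content `α`. -/
noncomputable def numSharpSylvesterClasses {n : ℕ} (α : Composition n) : ℕ :=
  Nat.card (Quotient ((Relation.EqvGen.setoid
    (SharpSylvesterAdj (A := Fin α.length))).comap (Subtype.val : WordsWithContent α → _)))

end ParkingPattern

/-! A parking function `p` of length `n` is the same as a triple `(α, y, w)`: the spots preferred by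
at least one car are `y_1 < ⋯ < y_k`, the numbers of cars preferring them form a composition `α` of
`n`, and `w` is the word of content `α` with `p = y ∘ w`. Cars can park if and only if
`y_i ≤ α_1 + ⋯ + α_{i-1}` (spots numbered from `0`), and such sequences `y` are the partial sums of
the lengths of the runs of down steps of the Dyck paths with ascent composition `α`. The
permutation `π(p)` is the inverse of the standardization of `w`, so that `π(p)` avoids `132` (or
`231`) if and only if `w` has no subword `a c b` (or `c a b`) with `a ≤ b < c`; similarly for `213`
and `312`, after reversing both the word and the order of the alphabet. This gives `pf_eq_sum`.

A Sylvester class contains exactly one word of each of the two kinds (`exists_avoids132`,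
`eq_of_avoids132`, `exists_avoids312`, `eq_of_avoids312`): the last letter `r` of a word, and the
classes of the subwords of letters `≤ r` and `> r` in front of it, are invariants of the class (they
are the root and the subtrees of the binary search tree of the word), and the avoiding words are
those in which the two subwords stand one after the other, in the order determined by the pattern,
at every level. Reversal with the opposite order on letters reduces `#`-Sylvester classes to
Sylvester classes.

All three counts are numbers of sequences `0 = y_0 < y_1 < ⋯ < y_m` with `y_i ≤ C i`, where
`m = k - 1`. For Dyck paths this is the description by spots, with `C i = α_1 + ⋯ + α_i`. For words
avoiding `132`, insert the letters from the largest to the smallest: all copies of a new smallest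
letter stand in one block, followed by a weakly increasing suffix. The length of the longest weakly
increasing suffix therefore determines the number of insertions, and the resulting recursion
`wordSum` becomes the one for sequences `y` after a substitution (`wordSum_eq_pathSum`). Finally,
expansion along the last row of the Hessenberg matrix with entries `multichoose (C i) (j + 1 - i)`
yields the same recursion as summation over the last coordinate of the sequences
(`detFrom1_multichoose`). -/

namespace ParkingPattern
open Finset

/-! ### Counting bounded increasing sequences by a Hessenberg determinant -/

/-- The sum of `φ y_m` over all integer sequences `0 = y_0 < y_1 < ⋯ < y_m` with `y_i ≤ C i` for
`1 ≤ i ≤ m`. -/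
def pathSum (C : ℕ → ℕ) : ℕ → (ℕ → ℤ) → ℤ
  | 0, φ => φ 0
  | m + 1, φ => pathSum C m fun y => ∑ t ∈ Ioc y (C (m + 1)), φ t

/-- Only the values of `φ` on the range of the last coordinate matter. -/
theorem pathSum_congr (C : ℕ → ℕ) (m : ℕ) {φ ψ : ℕ → ℤ} (h : ∀ y ≤ C m, φ y = ψ y) :
    pathSum C m φ = pathSum C m ψ := by
  cases m with
  | zero => exact h 0 (Nat.zero_le _)
  | succ m =>
    simp only [pathSum]
    congr 1
    funext y
    exact sum_congr rfl fun t ht => h t (mem_Ioc.1 ht).2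

theorem pathSum_const_sub (C : ℕ → ℕ) (m : ℕ) (c : ℤ) (ψ : ℕ → ℤ) :
    pathSum C m (fun y => c - ψ y) = c * pathSum C m (fun _ => 1) - pathSum C m ψ := by
  have key : ∀ (φ ψ : ℕ → ℤ) (c : ℤ),
      pathSum C m (fun y => c * φ y - ψ y) = c * pathSum C m φ - pathSum C m ψ := by
    induction m with
    | zero => intro φ ψ c; rfl
    | succ m ih =>
      intro φ ψ c
      simp only [pathSum, sum_sub_distrib, ← mul_sum, ih]
  simpa using key (fun _ => 1) ψ c

theorem sum_Ioc_multichoose (r : ℕ) {y c : ℕ} (h : y ≤ c) :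
    ∑ t ∈ Ioc y c, (t.multichoose r : ℤ) = c.multichoose (r + 1) - y.multichoose (r + 1) := by
  induction c, h using Nat.le_induction with
  | base => simp
  | succ c h ih =>
    rw [← insert_Ioc_right_eq_Ioc_add_one h, sum_insert (by simp), ih, Nat.multichoose_succ_succ]
    push_cast
    ring

/-- The telescoping identity that matches the expansion of a Hessenberg determinant along its last
row. -/
theorem pathSum_succ_multichoose {C : ℕ → ℕ} (hC : Monotone C) (m r : ℕ) :
    pathSum C (m + 1) (fun y => y.multichoose r) =
      (C (m + 1)).multichoose (r + 1) * pathSum C m (fun _ => 1) -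
        pathSum C m fun y => y.multichoose (r + 1) := by
  rw [← pathSum_const_sub]
  exact pathSum_congr C m fun y hy =>
    sum_Ioc_multichoose r (hy.trans (hC (Nat.le_succ m)))

/-- The determinant of the `(m + 1) × (m + 1)` matrix whose last column is `v` and whose other
columns are the first `m` columns of `a`; rows and columns of `a` are numbered from `1`. -/
def hessDet (a : ℕ → ℕ → ℤ) (v : ℕ → ℤ) (m : ℕ) : ℤ :=
  (Matrix.of fun i j : Fin (m + 1) => if (j : ℕ) < m then a (i + 1) (j + 1) else v (i + 1)).det

theorem detFrom1_succ (a : ℕ → ℕ → ℤ) (m : ℕ) :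
    detFrom1 (m + 1) a = hessDet a (fun i => a i (m + 1)) m := by
  unfold detFrom1 hessDet
  congr 1
  ext i j
  simp only [Matrix.of_apply]
  split_ifs with h
  · rfl
  · rw [show (j : ℕ) = m by omega]

/-- Expansion of a Hessenberg determinant along its last row, which has two nonzero entries. -/
theorem hessDet_succ {a : ℕ → ℕ → ℤ} (v : ℕ → ℤ) (m : ℕ) (h1 : a (m + 2) (m + 1) = 1)
    (h0 : ∀ j < m, a (m + 2) (j + 1) = 0) :
    hessDet a v (m + 1) = v (m + 2) * detFrom1 (m + 1) a - hessDet a v m := by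
  unfold hessDet
  rw [Matrix.det_succ_row _ (Fin.last (m + 1)), Fin.sum_univ_castSucc, Fin.sum_univ_castSucc,
    sum_eq_zero]
  · simp only [zero_add]
    have e1 : ((-1 : ℤ) ^ ((Fin.last (m + 1) : ℕ) + ((Fin.last m).castSucc : ℕ))) = -1 := by
      simp only [Fin.val_last, Fin.val_castSucc]
      exact Odd.neg_one_pow ⟨m, by ring⟩
    have e2 : ((-1 : ℤ) ^ ((Fin.last (m + 1) : ℕ) + (Fin.last (m + 1) : ℕ))) = 1 :=
      Even.neg_one_pow ⟨_, rfl⟩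
    rw [e1, e2]
    have e3 : ∀ (j : Fin (m + 1)),
        (((Fin.last m).castSucc.succAbove j : Fin (m + 2)) : ℕ) = if (j : ℕ) < m then (j : ℕ) else m + 1 := by
      intro j
      simp only [Fin.succAbove, Fin.lt_def, Fin.val_castSucc, Fin.val_last]
      split_ifs with h
      · rfl
      · simp only [Fin.val_succ]; omega
    simp only [Matrix.of_apply, Fin.val_last, Fin.val_castSucc, lt_add_iff_pos_right, zero_lt_one,
      if_true, lt_irrefl, if_false, h1]
    have e4 : (Matrix.of fun i j : Fin (m + 2) =>
        if (j : ℕ) < m + 1 then a (i + 1) (j + 1) else v (i + 1)).submatrix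
          (Fin.last (m + 1)).succAbove (Fin.last m).castSucc.succAbove =
        Matrix.of fun i j : Fin (m + 1) => if (j : ℕ) < m then a (i + 1) (j + 1) else v (i + 1) := by
      ext i j
      simp only [Matrix.submatrix_apply, Matrix.of_apply, e3, Fin.succAbove_last, Fin.val_castSucc]
      split_ifs <;> first | rfl | omega
    have e5 : (Matrix.of fun i j : Fin (m + 2) =>
        if (j : ℕ) < m + 1 then a (i + 1) (j + 1) else v (i + 1)).submatrix
          (Fin.last (m + 1)).succAbove (Fin.last (m + 1)).succAbove =
        Matrix.of fun i j : Fin (m + 1) => a (i + 1) (j + 1) := by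
      ext i j
      simp only [Matrix.submatrix_apply, Matrix.of_apply, Fin.succAbove_last, Fin.val_castSucc]
      rw [if_pos j.2]
    rw [e4, e5]
    unfold detFrom1
    ring
  · intro j _
    have hj : a (m + 1 + 1) ((j : ℕ) + 1) = 0 := h0 j j.2
    simp [hj]

/-- This Steck-type determinant counts the sequences `0 = y_0 < y_1 < ⋯ < y_m` with `y_i ≤ C i`. -/
theorem detFrom1_multichoose {C : ℕ → ℕ} (hC : Monotone C) (m : ℕ) :
    detFrom1 m (fun i j => if i ≤ j + 1 then ((C i).multichoose (j + 1 - i) : ℤ) else 0) =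
      pathSum C m fun _ => 1 := by
  set a : ℕ → ℕ → ℤ := fun i j => if i ≤ j + 1 then ((C i).multichoose (j + 1 - i) : ℤ) else 0
    with ha
  -- The induction needs the last column to be an arbitrary later column `J` of `a`: deleting the
  -- last row and the last column but one leaves a matrix of this kind.
  have key : ∀ m J, m < J →
      hessDet a (fun i => a i J) m = pathSum C (m + 1) fun y => y.multichoose (J - (m + 1)) := by
    intro m
    induction m with
    | zero =>
      intro J hJ
      rw [pathSum_succ_multichoose hC]
      obtain ⟨J, rfl⟩ : ∃ J', J = J' + 1 := ⟨J - 1, by omega⟩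
      simp [hessDet, pathSum, ha]
    | succ m ih =>
      intro J hJ
      rw [hessDet_succ _ _ (by simp [ha]) (fun j hj => by simp only [ha]; rw [if_neg (by omega)]),
        ih J (by omega), pathSum_succ_multichoose hC (m + 1), detFrom1_succ,
        ih (m + 1) (by omega), show J - (m + 1 + 1) + 1 = J - (m + 1) by omega]
      have e2 : J + 1 - (m + 2) = J - (m + 1) := by omega
      have e3 : m + 2 ≤ J + 1 := by omega
      simp [ha, e2, e3]
  cases m with
  | zero => simp [detFrom1, pathSum]
  | succ m =>
    rw [detFrom1_succ, key m (m + 1) (by omega)]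
    simp

theorem detFrom1_congr (m : ℕ) {a b : ℕ → ℕ → ℤ}
    (h : ∀ i j, 1 ≤ i → i ≤ m → a i j = b i j) : detFrom1 m a = detFrom1 m b := by
  unfold detFrom1
  congr 1
  ext i j
  exact h _ _ (by omega) (by omega)

theorem binom_natCast (a b : ℕ) : binom a b = (a.choose b : ℤ) := by
  simp [binom, Ring.choose_natCast]

/-- For `i = j + 1` both sides are `1`; the assumption on `c` keeps the upper entry of the binomial
coefficient nonnegative in that case. -/
theorem binom_eq_multichoose (c i j : ℕ) (hc : 1 ≤ c) :
    binom ((j : ℤ) - i + c) ((j : ℤ) - ((i : ℤ) - 1)) =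
      if i ≤ j + 1 then (c.multichoose (j + 1 - i) : ℤ) else 0 := by
  split_ifs with h
  · rw [Nat.multichoose_eq, ← binom_natCast]
    congr 1 <;> omega
  · rw [binom, if_neg (by omega)]

theorem detFrom1_binom {C : ℕ → ℕ} (hC : Monotone C) (m : ℕ) (hpos : ∀ i, 1 ≤ i → i ≤ m → 1 ≤ C i) :
    detFrom1 m (fun i j => binom ((j : ℤ) - i + C i) ((j : ℤ) - ((i : ℤ) - 1))) =
      pathSum C m fun _ => 1 := by
  rw [← detFrom1_multichoose hC]
  exact detFrom1_congr m fun i j hi him => binom_eq_multichoose _ i j (hpos i hi him)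

theorem one_le_sizeUpTo {n : ℕ} (α : Composition n) {i : ℕ} (hi : 1 ≤ i) (him : i ≤ α.length - 1) :
    1 ≤ α.sizeUpTo i := by
  have h := α.sizeUpTo_strict_mono (i := 0) (by omega)
  have h' := α.monotone_sizeUpTo hi
  simp only [Composition.sizeUpTo_zero] at h
  exact (Nat.succ_le_of_lt h).trans h'

theorem dyckDet_eq_pathSum {n : ℕ} (α : Composition n) :
    dyckDet α = pathSum α.sizeUpTo (α.length - 1) fun _ => 1 :=
  detFrom1_binom α.monotone_sizeUpTo _ fun _ => one_le_sizeUpTo α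

theorem sharpSylvesterDet_eq_pathSum {n : ℕ} (α : Composition n) :
    sharpSylvesterDet α = pathSum (fun i => α.sizeUpTo i + i) (α.length - 1) fun _ => 1 := by
  rw [← detFrom1_binom (fun i j h => Nat.add_le_add (α.monotone_sizeUpTo h) h) _
    (fun i _ _ => by omega)]
  refine detFrom1_congr _ fun i j _ _ => ?_
  congr 1
  push_cast
  ring

theorem length_reverse {n : ℕ} (α : Composition n) : α.reverse.length = α.length :=
  List.length_reverse

theorem sylvesterDet_eq_pathSum {n : ℕ} (α : Composition n) :
    sylvesterDet α = pathSum (fun i => α.reverse.sizeUpTo i + i) (α.length - 1) fun _ => 1 := by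
  have h := sharpSylvesterDet_eq_pathSum α.reverse
  rw [length_reverse] at h
  rw [← h, sharpSylvesterDet, sylvesterDet, length_reverse]

/-! ### Normal forms of Sylvester and `#`-Sylvester classes -/

theorem triplewise_sublist {A : Type*} {p : A → A → A → Prop} {x y : List A} (h : x.Sublist y)
    (hy : y.Triplewise p) : x.Triplewise p := by
  induction h with
  | slnil => exact hy
  | cons a _ ih => exact ih (List.triplewise_cons.1 hy).2
  | cons_cons a h ih =>
    obtain ⟨h1, h2⟩ := List.triplewise_cons.1 hy
    exact List.triplewise_cons.2 ⟨h1.sublist h, ih h2⟩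

/-- If no letter with `p` follows a letter without `p`, then the letters with `p` come first. -/
theorem eq_filter_append_of_pairwise {A : Type*} {x : List A} (p : A → Bool)
    (h : x.Pairwise fun c a => ¬ (p a = true ∧ p c = false)) :
    x = x.filter p ++ x.filter (fun a => !p a) := by
  induction x with
  | nil => rfl
  | cons c x ih =>
    rw [List.pairwise_cons] at h
    by_cases hc : p c
    · rw [List.filter_cons_of_pos hc, List.filter_cons_of_neg (by simp [hc]), List.cons_append,
        ← ih h.2]
    · have : ∀ a ∈ x, p a = false := fun a ha => by
        have h1 := h.1 a ha
        cases h2 : p a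
        · rfl
        · exact absurd ⟨h2, by simpa using hc⟩ h1
      have h1 : x.filter p = [] := by simpa using this
      have h2 : x.filter (fun a => !p a) = x := by simpa using this
      rw [List.filter_cons_of_neg hc, List.filter_cons_of_pos (by simp [hc]), h1, h2,
        List.nil_append]

section Sylvester
variable {A : Type*} [LinearOrder A]

/-- The word contains no subword `a c b` with `a ≤ b < c`. -/
def Avoids132 (w : List A) : Prop := w.Triplewise fun a c b => ¬ (a ≤ b ∧ b < c)

/-- The word contains no subword `c a b` with `a ≤ b < c`. -/
def Avoids312 (w : List A) : Prop := w.Triplewise fun c a b => ¬ (a ≤ b ∧ b < c)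

theorem eqvGen_append_right {w₁ w₂ : List A} (h : Relation.EqvGen SylvesterAdj w₁ w₂)
    (x : List A) : Relation.EqvGen SylvesterAdj (w₁ ++ x) (w₂ ++ x) := by
  induction h with
  | rel w₁ w₂ h =>
    obtain ⟨u, v, w, a, b, c, hab, hbc, rfl, rfl⟩ := h
    exact .rel _ _ ⟨u, v, w ++ x, a, b, c, hab, hbc, by simp, by simp⟩
  | refl _ => exact .refl _
  | symm _ _ _ ih => exact ih.symm
  | trans _ _ _ _ _ ih₁ ih₂ => exact ih₁.trans _ _ _ ih₂

theorem eqvGen_append_left {w₁ w₂ : List A} (h : Relation.EqvGen SylvesterAdj w₁ w₂)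
    (x : List A) : Relation.EqvGen SylvesterAdj (x ++ w₁) (x ++ w₂) := by
  induction h with
  | rel w₁ w₂ h =>
    obtain ⟨u, v, w, a, b, c, hab, hbc, rfl, rfl⟩ := h
    exact .rel _ _ ⟨x ++ u, v, w, a, b, c, hab, hbc, by simp, by simp⟩
  | refl _ => exact .refl _
  | symm _ _ _ ih => exact ih.symm
  | trans _ _ _ _ _ ih₁ ih₂ => exact ih₁.trans _ _ _ ih₂

theorem eqvGen_perm {w₁ w₂ : List A} (h : Relation.EqvGen SylvesterAdj w₁ w₂) : w₁.Perm w₂ := by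
  induction h with
  | rel w₁ w₂ h =>
    obtain ⟨u, v, w, a, b, c, hab, hbc, rfl, rfl⟩ := h
    have : [a, c].Perm [c, a] := List.Perm.swap _ _ _
    exact (((this.append_left u).append_right v).append_right [b]).append_right w
  | refl _ => exact .refl _
  | symm _ _ _ ih => exact ih.symm
  | trans _ _ _ _ _ ih₁ ih₂ => exact ih₁.trans ih₂

/-- A large letter `c` moves past a run of letters that are at most `r < c`, provided that `r`
occurs further to the right. -/
theorem eqvGen_move {r c : A} (hc : r < c) (x y : List A) (hx : ∀ a ∈ x, a ≤ r) :
    Relation.EqvGen SylvesterAdj (x ++ c :: y ++ [r]) (c :: x ++ y ++ [r]) := by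
  induction x with
  | nil => exact .refl _
  | cons a x ih =>
    have h1 := eqvGen_append_left (ih fun b hb => hx b (List.mem_cons_of_mem _ hb)) [a]
    refine Relation.EqvGen.trans _ _ _ (by simpa using h1) (.rel _ _ ?_)
    exact ⟨[], x ++ y, [], a, r, c, hx a List.mem_cons_self, hc, by simp, by simp⟩

/-- In front of a final letter `r`, all letters that are at most `r` can be moved to the front. -/
theorem eqvGen_partition_le (r : A) (x : List A) :
    Relation.EqvGen SylvesterAdj (x ++ [r]) (x.filter (· ≤ r) ++ x.filter (r < ·) ++ [r]) := by
  induction x with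
  | nil => exact .refl _
  | cons a x ih =>
    have h1 := eqvGen_append_left ih [a]
    rcases le_or_gt a r with h | h
    · simpa [List.filter_cons, h, not_lt.2 h] using h1
    · have h2 := eqvGen_move h (x.filter (· ≤ r)) (x.filter (r < ·)) (by simp)
      simp only [List.filter_cons, h, not_le.2 h]
      simp only [List.append_assoc, List.cons_append, List.nil_append] at h1 h2
      simpa using h1.trans _ _ _ h2.symm

/-- In front of a final letter `r`, all letters that exceed `r` can be moved to the front. -/
theorem eqvGen_partition_gt (r : A) (x : List A) :
    Relation.EqvGen SylvesterAdj (x ++ [r]) (x.filter (r < ·) ++ x.filter (· ≤ r) ++ [r]) := by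
  have key : ∀ y z : List A, (∀ a ∈ y, a ≤ r) → (∀ a ∈ z, r < a) →
      Relation.EqvGen SylvesterAdj (y ++ z ++ [r]) (z ++ y ++ [r]) := by
    intro y z hy hz
    induction z with
    | nil => simpa using Relation.EqvGen.refl _
    | cons c z ih =>
      have h1 := eqvGen_move (hz c List.mem_cons_self) y z hy
      have h2 := eqvGen_append_left (ih fun a ha => hz a (List.mem_cons_of_mem _ ha)) [c]
      exact h1.trans _ _ _ (by simpa using h2)
  exact (eqvGen_partition_le r x).trans _ _ _ (key _ _ (by simp) (by simp))

/-- Two words have the same last letter `r`, and in front of it the same Sylvester classes of the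
subwords of letters `≤ r` and of letters `> r`. -/
def SameRoot (w₁ w₂ : List A) : Prop :=
  w₁ = [] ∧ w₂ = [] ∨ ∃ (r : A) (x₁ x₂ : List A), w₁ = x₁ ++ [r] ∧ w₂ = x₂ ++ [r] ∧
    Relation.EqvGen SylvesterAdj (x₁.filter (· ≤ r)) (x₂.filter (· ≤ r)) ∧
    Relation.EqvGen SylvesterAdj (x₁.filter (r < ·)) (x₂.filter (r < ·))

/-- A restriction to an interval of letters either keeps all three letters of an elementary
Sylvester move or undoes the move. -/
theorem eqvGen_filter (p : A → Bool) (u v w : List A) {a b c : A} (hab : a ≤ b) (hbc : b < c)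
    (hp : p a → p c → p b) :
    Relation.EqvGen SylvesterAdj ((u ++ [a, c] ++ v ++ [b] ++ w).filter p)
      ((u ++ [c, a] ++ v ++ [b] ++ w).filter p) := by
  by_cases ha : p a <;> by_cases hc : p c
  · refine .rel _ _ ⟨u.filter p, v.filter p, w.filter p, a, b, c, hab, hbc, ?_, ?_⟩ <;>
      simp [ha, hc, hp ha hc]
  all_goals
    simp only [List.filter_append, List.filter_cons, ha, hc]
    exact .refl _

/-- The invariants of a Sylvester class at its last letter. An elementary move that ends at the last
letter `b` swaps a letter `≤ b` with a letter `> b`, which changes neither subword. -/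
theorem sameRoot_of_eqvGen {w₁ w₂ : List A} (h : Relation.EqvGen SylvesterAdj w₁ w₂) :
    SameRoot w₁ w₂ := by
  induction h with
  | rel w₁ w₂ h =>
    obtain ⟨u, v, w, a, b, c, hab, hbc, rfl, rfl⟩ := h
    right
    rcases List.eq_nil_or_concat' w with rfl | ⟨w, r, rfl⟩
    · refine ⟨b, u ++ [a, c] ++ v, u ++ [c, a] ++ v, by simp, by simp, ?_, ?_⟩
      · simpa [List.filter_cons, hab, not_le.2 hbc] using Relation.EqvGen.refl _
      · simpa [List.filter_cons, not_lt.2 hab, hbc] using Relation.EqvGen.refl _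
    · refine ⟨r, u ++ [a, c] ++ v ++ [b] ++ w, u ++ [c, a] ++ v ++ [b] ++ w, by simp, by simp,
        eqvGen_filter _ _ _ _ hab hbc ?_, eqvGen_filter _ _ _ _ hab hbc ?_⟩
      · simpa using fun _ h => hbc.le.trans h
      · simpa using fun h _ => h.trans_le hab
  | refl w =>
    rcases List.eq_nil_or_concat' w with rfl | ⟨w, r, rfl⟩
    · exact .inl ⟨rfl, rfl⟩
    · exact .inr ⟨r, w, w, rfl, rfl, .refl _, .refl _⟩
  | symm _ _ _ ih =>
    rcases ih with ⟨h, h'⟩ | ⟨r, x₁, x₂, h₁, h₂, h, h'⟩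
    · exact .inl ⟨h', h⟩
    · exact .inr ⟨r, x₂, x₁, h₂, h₁, h.symm, h'.symm⟩
  | trans _ _ _ _ _ ih₁ ih₂ =>
    rcases ih₁ with ⟨h, h'⟩ | ⟨r, x₁, x₂, h₁, h₂, h, h'⟩ <;>
      rcases ih₂ with ⟨k, k'⟩ | ⟨s, y₁, y₂, k₁, k₂, k, k'⟩
    · exact .inl ⟨h, k'⟩
    · simp [h'] at k₁
    · simp [k] at h₂
    · obtain ⟨rfl, hrs⟩ := List.append_inj' (h₂.symm.trans k₁) rfl
      obtain rfl : r = s := by simpa using hrs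
      exact .inr ⟨r, x₁, y₂, h₁, k₂, h.trans _ _ _ k, h'.trans _ _ _ k'⟩

theorem avoids312_concat {x : List A} {r : A} :
    Avoids312 (x ++ [r]) ↔ Avoids312 x ∧ x.Pairwise fun c a => ¬ (a ≤ r ∧ r < c) := by
  simp [Avoids312, List.triplewise_append]

theorem avoids132_concat {x : List A} {r : A} :
    Avoids132 (x ++ [r]) ↔ Avoids132 x ∧ x.Pairwise fun a c => ¬ (a ≤ r ∧ r < c) := by
  simp [Avoids132, List.triplewise_append]

theorem partition_of_avoids312 {x : List A} {r : A} (h : Avoids312 (x ++ [r])) :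
    x = x.filter (· ≤ r) ++ x.filter (r < ·) := by
  have := eq_filter_append_of_pairwise (x := x) (fun a => decide (a ≤ r))
    ((avoids312_concat.1 h).2.imp fun {c a} h => by simpa using h)
  simpa [← not_le] using this

theorem partition_of_avoids132 {x : List A} {r : A} (h : Avoids132 (x ++ [r])) :
    x = x.filter (r < ·) ++ x.filter (· ≤ r) := by
  have := eq_filter_append_of_pairwise (x := x) (fun a => decide (r < a))
    ((avoids132_concat.1 h).2.imp fun {c a} h => by simpa [and_comm] using h)
  simpa [← not_lt] using this

/-- If a hereditary property `P` forces the part of a word in front of its last letter `r` to be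
recoverable from its subwords of letters `≤ r` and of letters `> r`, then a Sylvester class contains
at most one word with the property `P`. -/
theorem unique_normal_form {P : List A → Prop} (join : List A → List A → List A)
    (hsub : ∀ x y, x.Sublist y → P y → P x)
    (hP : ∀ x r, P (x ++ [r]) → x = join (x.filter (· ≤ r)) (x.filter (r < ·)))
    {w₁ w₂ : List A} (h₁ : P w₁) (h₂ : P w₂) (h : Relation.EqvGen SylvesterAdj w₁ w₂) :
    w₁ = w₂ := by
  induction hn : w₁.length using Nat.strong_induction_on generalizing w₁ w₂ with
  | _ n ih =>
    rcases sameRoot_of_eqvGen h with ⟨rfl, rfl⟩ | ⟨r, x₁, x₂, rfl, rfl, hle, hgt⟩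
    · rfl
    · have hx : ∀ (p : A → Bool) (x : List A), (x.filter p).Sublist (x ++ [r]) := fun p x =>
        List.filter_sublist.trans (List.sublist_append_left _ _)
      have hlen : ∀ p : A → Bool, (x₁.filter p).length < n := fun p => by
        have := List.length_filter_le p x₁
        simp at hn
        omega
      rw [hP _ _ h₁, hP _ _ h₂, ih _ (hlen _) (hsub _ _ (hx _ _) h₁) (hsub _ _ (hx _ _) h₂) hle rfl,
        ih _ (hlen _) (hsub _ _ (hx _ _) h₁) (hsub _ _ (hx _ _) h₂) hgt rfl]

theorem eq_of_avoids312 {w₁ w₂ : List A} (h₁ : Avoids312 w₁) (h₂ : Avoids312 w₂)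
    (h : Relation.EqvGen SylvesterAdj w₁ w₂) : w₁ = w₂ :=
  unique_normal_form (fun x y => x ++ y) (fun _ _ => triplewise_sublist)
    (fun _ _ => partition_of_avoids312) h₁ h₂ h

theorem eq_of_avoids132 {w₁ w₂ : List A} (h₁ : Avoids132 w₁) (h₂ : Avoids132 w₂)
    (h : Relation.EqvGen SylvesterAdj w₁ w₂) : w₁ = w₂ :=
  unique_normal_form (fun x y => y ++ x) (fun _ _ => triplewise_sublist)
    (fun _ _ => partition_of_avoids132) h₁ h₂ h

/-- Induction on the length of a word: in front of the last letter `r`, the subwords `y` of letters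
`≤ r` and `z` of letters `> r` can be separated and brought to normal form one by one. -/
theorem exists_normal_form {P : List A → Prop} (h0 : P [])
    (hP : ∀ (r : A) (y z : List A), P y → P z → (∀ a ∈ y, a ≤ r) → (∀ a ∈ z, r < a) →
      ∃ w', P w' ∧ Relation.EqvGen SylvesterAdj (y ++ z ++ [r]) w') (w : List A) :
    ∃ w', P w' ∧ Relation.EqvGen SylvesterAdj w w' := by
  induction hn : w.length using Nat.strong_induction_on generalizing w with
  | _ n ih =>
    rcases List.eq_nil_or_concat' w with rfl | ⟨x, r, rfl⟩
    · exact ⟨[], h0, .refl _⟩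
    · have hlen : ∀ p : A → Bool, (x.filter p).length < n := fun p => by
        have := List.length_filter_le p x
        simp at hn
        omega
      obtain ⟨y, hy, hxy⟩ := ih _ (hlen (· ≤ r)) _ rfl
      obtain ⟨z, hz, hxz⟩ := ih _ (hlen (r < ·)) _ rfl
      obtain ⟨w', hw', h⟩ := hP r y z hy hz
        (fun a ha => by simpa using (List.mem_filter.1 ((eqvGen_perm hxy).mem_iff.2 ha)).2)
        (fun a ha => by simpa using (List.mem_filter.1 ((eqvGen_perm hxz).mem_iff.2 ha)).2)
      refine ⟨w', hw', (eqvGen_partition_le r x).trans _ _ _ (.trans _ _ _ ?_ h)⟩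
      exact eqvGen_append_right
        ((eqvGen_append_right hxy _).trans _ _ _ (eqvGen_append_left hxz _)) _

theorem exists_avoids312 (w : List A) :
    ∃ w', Avoids312 w' ∧ Relation.EqvGen SylvesterAdj w w' := by
  refine exists_normal_form (P := Avoids312) .nil (fun r y z hy hz hyr hzr => ?_) w
  refine ⟨y ++ z ++ [r], avoids312_concat.2 ⟨List.triplewise_append.2 ⟨hy, hz, ?_, ?_⟩, ?_⟩, .refl _⟩
  · exact fun c hc => List.pairwise_of_forall_mem_list fun a ha b hb => by
      have := hyr c hc; have := hzr a ha; have := hzr b hb; grind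
  · exact fun b hb => List.pairwise_of_forall_mem_list fun c hc a ha => by
      have := hyr c hc; have := hyr a ha; have := hzr b hb; grind
  · refine List.pairwise_append.2 ⟨?_, ?_, ?_⟩
    · exact List.pairwise_of_forall_mem_list fun c hc a ha => by have := hyr c hc; grind
    · exact List.pairwise_of_forall_mem_list fun c hc a ha => by have := hzr a ha; grind
    · exact fun c hc a ha => by have := hzr a ha; grind

theorem exists_avoids132 (w : List A) :
    ∃ w', Avoids132 w' ∧ Relation.EqvGen SylvesterAdj w w' := by
  refine exists_normal_form (P := Avoids132) .nil (fun r y z hy hz hyr hzr => ?_) w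
  refine ⟨z ++ y ++ [r], avoids132_concat.2 ⟨List.triplewise_append.2 ⟨hz, hy, ?_, ?_⟩, ?_⟩, ?_⟩
  · exact fun c hc => List.pairwise_of_forall_mem_list fun a ha b hb => by
      have := hzr c hc; have := hyr a ha; have := hyr b hb; grind
  · exact fun b hb => List.pairwise_of_forall_mem_list fun c hc a ha => by
      have := hzr c hc; have := hzr a ha; have := hyr b hb; grind
  · refine List.pairwise_append.2 ⟨?_, ?_, ?_⟩
    · exact List.pairwise_of_forall_mem_list fun c hc a ha => by have := hzr c hc; grind
    · exact List.pairwise_of_forall_mem_list fun c hc a ha => by have := hyr a ha; grind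
    · exact fun c hc a ha => by have := hzr c hc; grind
  · have h := eqvGen_partition_gt r (y ++ z)
    have h1 : y.filter (r < ·) = [] := by simpa using hyr
    have h2 : y.filter (· ≤ r) = y := by simpa using hyr
    have h3 : z.filter (r < ·) = z := by simpa using hzr
    have h4 : z.filter (· ≤ r) = [] := by simpa using hzr
    simpa only [List.filter_append, h1, h2, h3, h4, List.nil_append, List.append_nil] using h

end Sylvester

/-- Classes are counted by normal forms `N`. -/
theorem card_quotient_eq {X : Type*} (s : Setoid X) (N : X → Prop)
    (hex : ∀ x, ∃ y, N y ∧ s.r x y) (huniq : ∀ x y, N x → N y → s.r x y → x = y) :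
    Nat.card (Quotient s) = Nat.card {x // N x} := by
  symm
  refine Nat.card_congr (Equiv.ofBijective (fun x : {x // N x} => Quotient.mk s x) ⟨?_, ?_⟩)
  · rintro ⟨x, hx⟩ ⟨y, hy⟩ h
    exact Subtype.ext (huniq x y hx hy (Quotient.exact h))
  · intro q
    obtain ⟨x, rfl⟩ := Quotient.exists_rep q
    obtain ⟨y, hy, hxy⟩ := hex x
    exact ⟨⟨y, hy⟩, Quotient.sound (s.symm hxy)⟩

/-- Words of content `α` satisfying `N`. -/
abbrev ContentWords {n : ℕ} (α : Composition n) (N : List (Fin α.length) → Prop) : Type :=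
  {w : List (Fin α.length) // (∀ i, w.count i = α.blocksFun i) ∧ N w}

theorem card_classes_eq {n : ℕ} (α : Composition n)
    (R N : List (Fin α.length) → _)
    (hperm : ∀ {x y}, Relation.EqvGen R x y → x.Perm y)
    (hex : ∀ x, ∃ y, N y ∧ Relation.EqvGen R x y)
    (huniq : ∀ {x y}, N x → N y → Relation.EqvGen R x y → x = y) :
    Nat.card (Quotient ((Relation.EqvGen.setoid R).comap (Subtype.val : WordsWithContent α → _))) =
      Nat.card (ContentWords α N) := by
  refine (card_quotient_eq _ (fun x : WordsWithContent α => N x.1) ?_ ?_).trans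
    (Nat.card_congr (Equiv.subtypeSubtypeEquivSubtypeInter _ _))
  · rintro ⟨x, hx⟩
    obtain ⟨y, hy, hxy⟩ := hex x
    exact ⟨⟨y, fun i => by rw [← (hperm hxy).count_eq, hx]⟩, hy, hxy⟩
  · exact fun x y hx hy h => Subtype.ext (huniq hx hy h)

theorem numSylvesterClasses_eq_card_avoids312 {n : ℕ} (α : Composition n) :
    numSylvesterClasses α = Nat.card (ContentWords α Avoids312) :=
  card_classes_eq α _ _ eqvGen_perm exists_avoids312 eq_of_avoids312

theorem numSylvesterClasses_eq_card_avoids132 {n : ℕ} (α : Composition n) :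
    numSylvesterClasses α = Nat.card (ContentWords α Avoids132) :=
  card_classes_eq α _ _ eqvGen_perm exists_avoids132 eq_of_avoids132

section Sharp
variable {A : Type*}

/-- The reversal of a word, read over the alphabet with the opposite order. It exchanges
`#`-Sylvester and Sylvester equivalence. -/
def dualWord (w : List A) : List Aᵒᵈ := w.reverse.map OrderDual.toDual

/-- The inverse of `dualWord`. -/
def undualWord (w : List Aᵒᵈ) : List A := (w.map OrderDual.ofDual).reverse

@[simp] theorem undual_dual (w : List A) : undualWord (dualWord w) = w := by
  simp [undualWord, dualWord, Function.comp_def]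

@[simp] theorem dual_undual (w : List Aᵒᵈ) : dualWord (undualWord w) = w := by
  simp [undualWord, dualWord, Function.comp_def]

variable [LinearOrder A]

theorem eqvGen_dualWord {w₁ w₂ : List A} (h : Relation.EqvGen SharpSylvesterAdj w₁ w₂) :
    Relation.EqvGen SylvesterAdj (dualWord w₁) (dualWord w₂) := by
  induction h with
  | rel w₁ w₂ h =>
    obtain ⟨u, v, w, a, b, c, hab, hbc, rfl, rfl⟩ := h
    exact .rel _ _ ⟨dualWord w, dualWord v, dualWord u, OrderDual.toDual c, OrderDual.toDual b,
      OrderDual.toDual a, hbc, hab, by simp [dualWord], by simp [dualWord]⟩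
  | refl _ => exact .refl _
  | symm _ _ _ ih => exact ih.symm
  | trans _ _ _ _ _ ih₁ ih₂ => exact ih₁.trans _ _ _ ih₂

theorem eqvGen_undualWord {w₁ w₂ : List Aᵒᵈ} (h : Relation.EqvGen SylvesterAdj w₁ w₂) :
    Relation.EqvGen SharpSylvesterAdj (undualWord w₁) (undualWord w₂) := by
  induction h with
  | rel w₁ w₂ h =>
    obtain ⟨u, v, w, a, b, c, hab, hbc, rfl, rfl⟩ := h
    exact .rel _ _ ⟨undualWord w, undualWord v, undualWord u, OrderDual.ofDual c,
      OrderDual.ofDual b, OrderDual.ofDual a, hbc, hab, by simp [undualWord], by simp [undualWord]⟩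
  | refl _ => exact .refl _
  | symm _ _ _ ih => exact ih.symm
  | trans _ _ _ _ _ ih₁ ih₂ => exact ih₁.trans _ _ _ ih₂

theorem sharp_perm {w₁ w₂ : List A} (h : Relation.EqvGen SharpSylvesterAdj w₁ w₂) :
    w₁.Perm w₂ := by
  have h' := (eqvGen_perm (eqvGen_dualWord h)).map OrderDual.ofDual
  simpa [dualWord, Function.comp_def, List.reverse_perm'] using h'

end Sharp

theorem card_sharp_classes {n : ℕ} (α : Composition n) (N : List (Fin α.length)ᵒᵈ → Prop)
    (hex : ∀ x, ∃ y, N y ∧ Relation.EqvGen SylvesterAdj x y)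
    (huniq : ∀ {x y}, N x → N y → Relation.EqvGen SylvesterAdj x y → x = y) :
    numSharpSylvesterClasses α = Nat.card (ContentWords α fun w => N (dualWord w)) := by
  refine card_classes_eq α _ _ sharp_perm (fun x => ?_) (fun {x y} hx hy h => ?_)
  · obtain ⟨y, hy, hxy⟩ := hex (dualWord x)
    exact ⟨undualWord y, by simpa using hy, by simpa using eqvGen_undualWord hxy⟩
  · simpa using congrArg undualWord (huniq hx hy (eqvGen_dualWord h))

theorem numSharpSylvesterClasses_eq_card_avoids312 {n : ℕ} (α : Composition n) :
    numSharpSylvesterClasses α = Nat.card (ContentWords α fun w => Avoids312 (dualWord w)) :=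
  card_sharp_classes α _ exists_avoids312 eq_of_avoids312

theorem numSharpSylvesterClasses_eq_card_avoids132 {n : ℕ} (α : Composition n) :
    numSharpSylvesterClasses α = Nat.card (ContentWords α fun w => Avoids132 (dualWord w)) :=
  card_sharp_classes α _ exists_avoids132 eq_of_avoids132

/-! ### Counting words that avoid `132` -/

section Count
variable {A : Type*} [LinearOrder A]

/-- The length of the longest weakly increasing suffix of a word. -/
def incTail : List A → ℕ
  | [] => 0
  | a :: w => if (a :: w).Pairwise (· ≤ ·) then w.length + 1 else incTail w

theorem incTail_le_length (w : List A) : incTail w ≤ w.length := by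
  induction w with
  | nil => simp [incTail]
  | cons a w ih =>
    rw [incTail]
    split_ifs
    · simp
    · exact ih.trans (by simp)

theorem pairwise_drop_of_le_incTail {w : List A} {s : ℕ} (h : s ≤ incTail w) :
    (w.drop (w.length - s)).Pairwise (· ≤ ·) := by
  induction w with
  | nil => simp
  | cons a w ih =>
    rw [incTail] at h
    split_ifs at h with hw
    · exact hw.sublist (List.drop_sublist _ _)
    · have := h.trans (incTail_le_length w)
      rw [List.length_cons, show w.length + 1 - s = w.length - s + 1 by omega, List.drop_succ_cons]
      exact ih h

theorem length_le_incTail (u : List A) {v : List A} (hv : v.Pairwise (· ≤ ·)) :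
    v.length ≤ incTail (u ++ v) := by
  induction u with
  | nil =>
    cases v with
    | nil => simp
    | cons a v => rw [List.nil_append, incTail, if_pos hv, List.length_cons]
  | cons a u ih =>
    rw [List.cons_append, incTail]
    split_ifs
    · simp; omega
    · exact ih

theorem incTail_append_cons {u v : List A} {a : A} (hu : ∀ y ∈ u, a < y)
    (hv : (a :: v).Pairwise (· ≤ ·)) : incTail (u ++ a :: v) = v.length + 1 := by
  induction u with
  | nil => rw [List.nil_append, incTail, if_pos hv]
  | cons y u ih =>
    rw [List.cons_append, incTail, if_neg, ih fun z hz => hu z (List.mem_cons_of_mem _ hz)]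
    intro h
    exact absurd (hu y List.mem_cons_self) (not_lt.2 ((List.pairwise_cons.1 h).1 a (by simp)))

open Classical in
/-- The words with letters `M` (counted with multiplicity) that avoid `132`. -/
noncomputable def words132 (M : Multiset A) : Finset (List A) := M.lists.toFinset.filter Avoids132

theorem mem_words132 {M : Multiset A} {w : List A} :
    w ∈ words132 M ↔ (w : Multiset A) = M ∧ Avoids132 w := by
  simp [words132, Multiset.mem_lists_iff, eq_comm]

/-- Insertion of a block of the smallest letter `a` in front of a weakly increasing suffix. -/
theorem avoids132_insert {a : A} {u v : List A} (c : ℕ) (hu : ∀ y ∈ u, a < y) (hv : ∀ y ∈ v, a < y)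
    (hs : v.Pairwise (· ≤ ·)) (h : Avoids132 (u ++ v)) :
    Avoids132 (u ++ (List.replicate c a ++ v)) := by
  obtain ⟨h1, h2, h3, h4⟩ := List.triplewise_append.1 h
  have hav : (List.replicate c a ++ v).Pairwise (· ≤ ·) :=
    List.pairwise_append.2 ⟨List.pairwise_replicate.2 (.inr le_rfl), hs, fun x hx y hy => by
      rw [List.eq_of_mem_replicate hx]; exact (hv y hy).le⟩
  refine List.triplewise_append.2 ⟨h1, ?_, fun x hx => ?_, fun x hx => ?_⟩
  · refine List.triplewise_iff_getElem.2 fun i j k hij hjk hk ⟨_, hlt⟩ => ?_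
    exact absurd hlt (not_lt.2 (List.pairwise_iff_getElem.1 hav j k _ hk hjk))
  · exact hav.imp fun h h' => absurd h'.2 (not_lt.2 h)
  · rcases List.mem_append.1 hx with hx | hx
    · rw [List.eq_of_mem_replicate hx]
      exact List.pairwise_of_forall_mem_list fun y hy z _ h' => absurd h'.1 (not_le.2 (hu y hy))
    · exact h4 x hx

/-- A `132`-avoiding word whose smallest letter `a` occurs `c ≥ 1` times arises by insertion of a
block of letters `a` in front of a weakly increasing suffix. -/
theorem exists_eq_insert {a : A} {c : ℕ} (hc : 1 ≤ c) {M : Multiset A} (hM : ∀ y ∈ M, a < y)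
    {x : List A} (hx : x ∈ words132 (Multiset.replicate c a + M)) :
    ∃ u v : List A, x = u ++ (List.replicate c a ++ v) ∧ v.Pairwise (· ≤ ·) ∧
      ((u ++ v : List A) : Multiset A) = M ∧ Avoids132 (u ++ v) := by
  obtain ⟨hxM, hav⟩ := mem_words132.1 hx
  have hle : ∀ y ∈ x, a ≤ y := fun y hy => by
    have : y ∈ Multiset.replicate c a + M := hxM ▸ Multiset.mem_coe.2 hy
    rcases Multiset.mem_add.1 this with h | h
    · exact (Multiset.eq_of_mem_replicate h).ge
    · exact (hM y h).le
  have hcount : x.count a = c := by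
    rw [← Multiset.coe_count, hxM, Multiset.count_add, Multiset.count_replicate_self,
      Multiset.count_eq_zero_of_notMem fun h => (hM a h).false, add_zero]
  obtain ⟨u, t, rfl, hu⟩ := List.eq_append_cons_of_mem
    (List.count_pos_iff.1 (show 0 < x.count a by omega))
  have ht : (a :: t).Pairwise (· ≤ ·) := by
    refine List.pairwise_cons.2 ⟨fun y hy => hle y (by simp [hy]), ?_⟩
    have := (List.triplewise_cons.1 (List.triplewise_append.1 hav).2.1).1
    refine this.imp_of_mem fun {y z} _ hz h => ?_
    exact not_lt.1 fun hlt => h ⟨hle z (by simp [hz]), hlt⟩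
  have hsplit := eq_filter_append_of_pairwise (x := a :: t) (fun y => decide (y = a))
    (ht.imp_of_mem fun {y z} hy _ h h' => by
      simp only [decide_eq_true_eq, decide_eq_false_iff_not] at h'
      exact h'.2 (le_antisymm (h'.1 ▸ h) (hle y (by simp at hy ⊢; tauto))))
  rw [List.filter_eq, show List.count a (a :: t) = c by
    rw [← hcount, List.count_append, List.count_eq_zero_of_not_mem hu, zero_add]] at hsplit
  set v := (a :: t).filter fun y => !decide (y = a)
  have hsub : (u ++ v).Sublist (u ++ a :: t) := (List.filter_sublist).append_left u
  refine ⟨u, v, by rw [← hsplit], ht.sublist List.filter_sublist, ?_,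
    triplewise_sublist hsub hav⟩
  rw [hsplit] at hxM
  rw [← add_right_inj (Multiset.replicate c a), ← hxM, ← Multiset.coe_replicate,
    Multiset.coe_add, Multiset.coe_eq_coe, ← List.append_assoc, ← List.append_assoc]
  exact (List.perm_append_comm).append_right v

/-- The block of smallest letters can be inserted in front of any weakly increasing suffix; if this
suffix has length `s`, the longest weakly increasing suffix afterwards has length `c + s`. -/
theorem sum_words132_add_replicate {a : A} {c : ℕ} (hc : 1 ≤ c) {M : Multiset A}
    (hM : ∀ y ∈ M, a < y) (φ : ℕ → ℤ) :
    ∑ w ∈ words132 (Multiset.replicate c a + M), φ (incTail w) =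
      ∑ w ∈ words132 M, ∑ s ∈ range (incTail w + 1), φ (c + s) := by
  rw [sum_sigma']
  symm
  have hlt : ∀ w ∈ words132 M, ∀ y ∈ w, a < y := fun w hw y hy =>
    hM y ((mem_words132.1 hw).1 ▸ Multiset.mem_coe.2 hy)
  refine sum_bij (fun (p : (_ : List A) × ℕ) _ => p.1.take (p.1.length - p.2) ++
    (List.replicate c a ++ p.1.drop (p.1.length - p.2))) ?_ ?_ ?_ ?_
  · rintro ⟨w, s⟩ hp
    obtain ⟨hw, hs⟩ := mem_sigma.1 hp
    obtain ⟨hwM, hav⟩ := mem_words132.1 hw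
    simp only [mem_range, Nat.lt_succ_iff] at hs
    refine mem_words132.2 ⟨?_, avoids132_insert c
      (fun y hy => hlt w hw y (List.mem_of_mem_take hy))
      (fun y hy => hlt w hw y (List.mem_of_mem_drop hy)) (pairwise_drop_of_le_incTail hs)
      (by rwa [List.take_append_drop])⟩
    rw [← hwM, ← Multiset.coe_replicate, Multiset.coe_add, Multiset.coe_eq_coe]
    simp only
    have h := ((List.perm_append_comm (l₁ := w.take (w.length - s))
      (l₂ := List.replicate c a)).append_right (w.drop (w.length - s)))
    simpa only [List.append_assoc, List.take_append_drop] using h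
  · rintro ⟨w, s⟩ hp ⟨w', s'⟩ hp' h
    obtain ⟨hw, hs⟩ := mem_sigma.1 hp
    obtain ⟨hw', hs'⟩ := mem_sigma.1 hp'
    have hs1 := incTail_le_length w
    have hs1' := incTail_le_length w'
    simp only [mem_range] at hs hs'
    obtain ⟨c, rfl⟩ : ∃ d, c = d + 1 := ⟨c - 1, by omega⟩
    -- The part in front of the inserted block is the longest prefix without the letter `a`.
    have key : ∀ (x y : List A), (∀ z ∈ x, a < z) →
        (x ++ (List.replicate (c + 1) a ++ y)).takeWhile (fun z => decide (a < z)) = x := by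
      intro x y hx
      rw [List.takeWhile_append_of_pos (by simpa using hx), List.replicate_succ, List.cons_append,
        List.takeWhile_cons_of_neg (by simp), List.append_nil]
    have e1 := congrArg (List.takeWhile fun z => decide (a < z)) h
    simp only at e1
    rw [key _ _ fun y hy => hlt w hw y (List.mem_of_mem_take hy),
      key _ _ fun y hy => hlt w' hw' y (List.mem_of_mem_take hy)] at e1
    simp only [e1, List.append_cancel_left_eq] at h
    have e2 : w = w' := by
      rw [← List.take_append_drop (w.length - s) w, e1, h, List.take_append_drop]
    subst e2
    have e3 := congrArg List.length h
    simp only [List.length_drop] at e3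
    rw [show s = s' by omega]
  · intro x hx
    obtain ⟨u, v, rfl, hv, huv, hav⟩ := exists_eq_insert hc hM hx
    refine ⟨⟨u ++ v, v.length⟩, mem_sigma.2 ⟨mem_words132.2 ⟨huv, hav⟩,
      mem_range.2 (Nat.lt_succ_of_le (length_le_incTail u hv))⟩, ?_⟩
    simp
  · rintro ⟨w, s⟩ hp
    obtain ⟨hw, hs⟩ := mem_sigma.1 hp
    have hs1 := incTail_le_length w
    simp only [mem_range, Nat.lt_succ_iff] at hs
    obtain ⟨c, rfl⟩ : ∃ d, c = d + 1 := ⟨c - 1, by omega⟩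
    have hsort : (List.replicate (c + 1) a ++ w.drop (w.length - s)).Pairwise (· ≤ ·) :=
      List.pairwise_append.2 ⟨List.pairwise_replicate.2 (.inr le_rfl),
        pairwise_drop_of_le_incTail hs, fun x hx y hy => by
          rw [List.eq_of_mem_replicate hx]; exact (hlt w hw y (List.mem_of_mem_drop hy)).le⟩
    simp only [List.replicate_succ, List.cons_append] at hsort ⊢
    rw [incTail_append_cons (fun y hy => hlt w hw y (List.mem_of_mem_take hy)) hsort]
    congr 1
    simp
    omega

/-- The recursion for the number of `132`-avoiding words, with the multiplicities of the letters
listed from the smallest letter to the largest. The argument of `φ` is `incTail`. -/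
def wordSum : List ℕ → (ℕ → ℤ) → ℤ
  | [], φ => φ 0
  | c :: l, φ => wordSum l fun m => ∑ s ∈ range (m + 1), φ (c + s)

/-- The multiset with the given letters and multiplicities. -/
def lettersOf (l : List (A × ℕ)) : Multiset A := (l.map fun p => Multiset.replicate p.2 p.1).sum

theorem exists_of_mem_lettersOf {A : Type*} {l : List (A × ℕ)} {y : A} (hy : y ∈ lettersOf l) :
    ∃ q ∈ l, y = q.1 := by
  induction l with
  | nil => simp [lettersOf] at hy
  | cons p l ih =>
    rw [lettersOf, List.map_cons, List.sum_cons, Multiset.mem_add] at hy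
    rcases hy with hy | hy
    · exact ⟨p, List.mem_cons_self, Multiset.eq_of_mem_replicate hy⟩
    · obtain ⟨q, hq, h⟩ := ih hy
      exact ⟨q, List.mem_cons_of_mem _ hq, h⟩

theorem sum_words132 {l : List (A × ℕ)} (hl : l.Pairwise fun p q => p.1 < q.1)
    (hpos : ∀ p ∈ l, 1 ≤ p.2) (φ : ℕ → ℤ) :
    ∑ w ∈ words132 (lettersOf l), φ (incTail w) = wordSum (l.map Prod.snd) φ := by
  induction l generalizing φ with
  | nil =>
    have : words132 (0 : Multiset A) = {[]} := by
      ext w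
      simp only [mem_words132, Multiset.coe_eq_zero, mem_singleton, and_iff_left_iff_imp]
      rintro rfl
      exact .nil
    simp [lettersOf, wordSum, this, incTail]
  | cons p l ih =>
    rw [List.pairwise_cons] at hl
    have hM : ∀ y ∈ lettersOf l, p.1 < y := by
      intro y hy
      obtain ⟨q, hq, hyq⟩ := exists_of_mem_lettersOf hy
      rw [hyq]
      exact hl.1 q hq
    rw [lettersOf, List.map_cons, List.sum_cons, List.map_cons, wordSum, ← lettersOf,
      sum_words132_add_replicate (hpos p List.mem_cons_self) hM,
      ← ih hl.2 fun q hq => hpos q (List.mem_cons_of_mem _ hq)]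

theorem card_avoids132 {l : List (A × ℕ)} (hl : l.Pairwise fun p q => p.1 < q.1)
    (hpos : ∀ p ∈ l, 1 ≤ p.2) :
    (Nat.card {w : List A // (w : Multiset A) = lettersOf l ∧ Avoids132 w} : ℤ) =
      wordSum (l.map Prod.snd) fun _ => 1 := by
  rw [← sum_words132 hl hpos, sum_const, nsmul_one, Nat.cast_inj, ← Nat.card_eq_finsetCard]
  exact Nat.card_congr (Equiv.subtypeEquivRight fun w => mem_words132.symm)

end Count

/-- The substitution `y ↦ C m - y` turns the recursion for words into the one for lattice paths. -/
theorem wordSum_eq_pathSum {C : ℕ → ℕ} (h0 : C 0 = 0) (b : ℕ) (l : List ℕ)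
    (hC : ∀ i (hi : i < l.reverse.length), C (i + 1) = C i + l.reverse[i] + 1) (φ : ℕ → ℤ) :
    wordSum (b :: l) φ = pathSum C l.length fun y => φ (b + (C l.length - y)) := by
  induction l generalizing b φ with
  | nil => simp [wordSum, pathSum, h0]
  | cons b' l ih =>
    have hC' : C (l.length + 1) = C l.length + b' + 1 := by
      have := hC l.length (by simp)
      simpa using this
    rw [wordSum, ih, List.length_cons, pathSum]
    · refine pathSum_congr _ _ fun y hy => ?_
      rw [show b' + (C l.length - y) + 1 = C (l.length + 1) - y by omega]
      refine sum_bij' (fun s _ => C (l.length + 1) - s) (fun t _ => C (l.length + 1) - t)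
        ?_ ?_ ?_ ?_ ?_ <;> intro s hs <;> simp only [mem_range, mem_Ioc] at hs ⊢
      · omega
      · omega
      · omega
      · omega
      · congr 2; omega
    · intro i hi
      have := hC i (by simp at hi ⊢; omega)
      rw [this]
      simp only [List.reverse_cons]
      rw [List.getElem_append_left hi]

/-! ### Sylvester classes and determinants -/

/-- The multiset of letters of a word with packed content `α`. -/
def contentMultiset {n : ℕ} (α : Composition n) : Multiset (Fin α.length) :=
  ∑ i, Multiset.replicate (α.blocksFun i) i

theorem count_eq_iff {n : ℕ} (α : Composition n) (w : List (Fin α.length)) :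
    (∀ i, w.count i = α.blocksFun i) ↔ (w : Multiset (Fin α.length)) = contentMultiset α := by
  rw [Multiset.ext]
  refine forall_congr' fun i => ?_
  rw [Multiset.coe_count, contentMultiset, Multiset.count_sum']
  simp [Multiset.count_replicate]

theorem lettersOf_blocks {n : ℕ} (α : Composition n) :
    lettersOf (List.ofFn fun i => (i, α.blocksFun i)) = contentMultiset α := by
  simp [lettersOf, contentMultiset, List.map_ofFn, List.sum_ofFn]

theorem lettersOf_reverse_blocks {n : ℕ} (α : Composition n) :
    lettersOf (List.ofFn fun i => (OrderDual.toDual i, α.blocksFun i)).reverse =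
      (contentMultiset α).map OrderDual.toDual := by
  rw [lettersOf, List.map_reverse, List.sum_reverse, contentMultiset, ← Multiset.coe_mapAddMonoidHom,
    map_sum]
  simp [List.map_ofFn, List.sum_ofFn]

theorem card_contentWords_avoids132 {n : ℕ} (α : Composition n) :
    (Nat.card (ContentWords α Avoids132) : ℤ) = wordSum α.blocks fun _ => 1 := by
  have h := card_avoids132 (l := List.ofFn fun i => (i, α.blocksFun i))
    (List.pairwise_ofFn.2 fun i j h => h) (List.forall_mem_ofFn_iff.2 α.one_le_blocksFun)
  rw [List.map_ofFn, show Prod.snd ∘ (fun i => (i, α.blocksFun i)) = α.blocksFun from rfl,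
    α.ofFn_blocksFun] at h
  rw [← h, lettersOf_blocks]
  simp only [← count_eq_iff]

theorem card_contentWords_avoids132_dualWord {n : ℕ} (α : Composition n) :
    (Nat.card (ContentWords α fun w => Avoids132 (dualWord w)) : ℤ) =
      wordSum α.blocks.reverse fun _ => 1 := by
  have h := card_avoids132 (l := (List.ofFn fun i => (OrderDual.toDual i, α.blocksFun i)).reverse)
    (List.pairwise_reverse.2 (List.pairwise_ofFn.2 fun i j h => h))
    (fun p hp => (List.forall_mem_ofFn_iff (P := fun p : (Fin α.length)ᵒᵈ × ℕ => 1 ≤ p.2)).2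
      α.one_le_blocksFun p (List.mem_reverse.1 hp))
  rw [List.map_reverse, List.map_ofFn,
    show Prod.snd ∘ (fun i => (OrderDual.toDual i, α.blocksFun i)) = α.blocksFun from rfl,
    α.ofFn_blocksFun] at h
  rw [← h, lettersOf_reverse_blocks, Nat.cast_inj]
  refine Nat.card_congr (Equiv.subtypeEquiv ⟨dualWord, undualWord, undual_dual, dual_undual⟩ ?_)
  intro w
  have e : ((dualWord w : List (Fin α.length)ᵒᵈ) : Multiset (Fin α.length)ᵒᵈ) =
      (w : Multiset (Fin α.length)).map OrderDual.toDual := by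
    simp [dualWord]
  rw [count_eq_iff, Equiv.coe_fn_mk, e, (Multiset.map_injective OrderDual.toDual.injective).eq_iff]

/-- The number of words in terms of lattice paths bounded by the reversed composition. -/
theorem wordSum_blocks {n : ℕ} (α : Composition n) :
    wordSum α.blocks (fun _ => 1) =
      pathSum (fun i => α.reverse.sizeUpTo i + i) (α.length - 1) fun _ => 1 := by
  have hr : α.reverse.blocks = α.blocks.reverse := rfl
  have hlen : α.length = α.blocks.length := rfl
  rw [hlen]
  cases hb : α.blocks with
  | nil => simp [wordSum, pathSum]
  | cons b l =>
    rw [hb] at hr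
    rw [wordSum_eq_pathSum (C := fun i => α.reverse.sizeUpTo i + i) (by simp), List.length_cons,
      Nat.add_sub_cancel]
    intro i hi
    have hi' : i < α.reverse.length := by
      rw [← Composition.blocks_length, hr]
      simp at hi ⊢
      omega
    have hget : α.reverse.blocks[i] = l.reverse[i] := by
      simp only [hr, List.reverse_cons]
      rw [List.getElem_append_left hi]
    rw [Composition.sizeUpTo_succ _ hi', hget]
    ring

theorem numSylvesterClasses_eq {n : ℕ} (α : Composition n) :
    (numSylvesterClasses α : ℤ) = sylvesterDet α := by
  rw [numSylvesterClasses_eq_card_avoids132, card_contentWords_avoids132, wordSum_blocks,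
    sylvesterDet_eq_pathSum]

theorem numSharpSylvesterClasses_eq {n : ℕ} (α : Composition n) :
    (numSharpSylvesterClasses α : ℤ) = sharpSylvesterDet α := by
  have h := wordSum_blocks α.reverse
  rw [length_reverse, Composition.reverse_reverse] at h
  rw [numSharpSylvesterClasses_eq_card_avoids132, card_contentWords_avoids132_dualWord,
    sharpSylvesterDet_eq_pathSum, ← h]
  rfl

/-! ### Dyck paths with a given ascent composition -/

/-- The sequences of spots `y_1 < ⋯ < y_k`, numbered from `0`, for which all cars can park when
`α_i` of them prefer the spot `y_i`: in front of `y_i` there are at most as many spots as cars that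
prefer them. -/
abbrev SpotSeq {n : ℕ} (α : Composition n) : Type :=
  {y : Fin α.length → ℕ // StrictMono y ∧ ∀ i, y i ≤ α.sizeUpTo i}

/-- The sequences `y_0 < ⋯ < y_m` with `y_i ≤ C i`. -/
def boundedSeqs (C : ℕ → ℕ) (m : ℕ) : Finset (Fin (m + 1) → ℕ) :=
  (Fintype.piFinset fun i : Fin (m + 1) => range (C i + 1)).filter fun y =>
    ∀ i : Fin m, y i.castSucc < y i.succ

theorem mem_boundedSeqs {C : ℕ → ℕ} {m : ℕ} {y : Fin (m + 1) → ℕ} :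
    y ∈ boundedSeqs C m ↔ (∀ i, y i ≤ C i) ∧ ∀ i : Fin m, y i.castSucc < y i.succ := by
  simp [boundedSeqs]

theorem sum_boundedSeqs {C : ℕ → ℕ} (h0 : C 0 = 0) (m : ℕ) (φ : ℕ → ℤ) :
    ∑ y ∈ boundedSeqs C m, φ (y (Fin.last m)) = pathSum C m φ := by
  induction m generalizing φ with
  | zero =>
    have : boundedSeqs C 0 = {fun _ => 0} := by
      ext y
      simp only [mem_boundedSeqs, mem_singleton, funext_iff]
      simp [Fin.forall_fin_one, h0]
    simp [this, pathSum]
  | succ m ih =>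
    rw [pathSum, ← ih, sum_sigma']
    refine sum_bij' (fun y _ => ⟨Fin.init y, y (Fin.last (m + 1))⟩)
      (fun p _ => Fin.snoc (α := fun _ => ℕ) p.1 p.2) ?_ ?_ ?_ ?_ ?_
    · intro y hy
      obtain ⟨h1, h2⟩ := mem_boundedSeqs.1 hy
      refine mem_sigma.2 ⟨mem_boundedSeqs.2 ⟨fun i => h1 i.castSucc, fun i => h2 i.castSucc⟩,
        mem_Ioc.2 ⟨h2 (Fin.last m), h1 (Fin.last (m + 1))⟩⟩
    · rintro ⟨y, t⟩ hp
      obtain ⟨hy, ht⟩ := mem_sigma.1 hp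
      obtain ⟨h1, h2⟩ := mem_boundedSeqs.1 hy
      obtain ⟨ht1, ht2⟩ := mem_Ioc.1 ht
      refine mem_boundedSeqs.2 ⟨fun i => ?_, fun i => ?_⟩
      · induction i using Fin.lastCases with
        | last => simpa using ht2
        | cast i => simpa using h1 i
      · induction i using Fin.lastCases with
        | last => simpa using ht1
        | cast i =>
          rw [← Fin.castSucc_succ]
          simpa only [Fin.snoc_castSucc] using h2 i
    · intro y _
      simp
    · rintro ⟨y, t⟩ _
      simp
    · intro y _
      rfl

theorem card_spotSeq {n : ℕ} (α : Composition n) :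
    (Nat.card (SpotSeq α) : ℤ) = pathSum α.sizeUpTo (α.length - 1) fun _ => 1 := by
  have key : ∀ k m, k = m + 1 → (Nat.card {y : Fin k → ℕ // StrictMono y ∧
      ∀ i, y i ≤ α.sizeUpTo i} : ℤ) = pathSum α.sizeUpTo m fun _ => 1 := by
    rintro _ m rfl
    rw [← sum_boundedSeqs (by simp), sum_const, nsmul_one, Nat.cast_inj, ← Nat.card_eq_finsetCard]
    exact Nat.card_congr (Equiv.subtypeEquivRight fun y => by
      rw [mem_boundedSeqs, Fin.strictMono_iff_lt_succ, and_comm])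
  rcases Nat.eq_zero_or_pos α.length with h | h
  · have : IsEmpty (Fin α.length) := by rw [h]; infer_instance
    have : Unique (SpotSeq α) :=
      ⟨⟨⟨isEmptyElim, fun i => isEmptyElim i, fun i => isEmptyElim i⟩⟩,
        fun y => Subtype.ext (funext fun i => isEmptyElim i)⟩
    simp [h, pathSum]
  · exact key _ _ (by omega)

/-- Every prefix of the word, started at height `h`, stays at nonnegative height. -/
def StaysNonneg (h : ℕ) (w : List DyckStep) : Prop :=
  ∀ i, (w.take i).count DyckStep.D ≤ h + (w.take i).count DyckStep.U

/-- The word `U^{a_1} D^{d_1} U^{a_2} D^{d_2} ⋯`. -/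
def runWord (l : List (ℕ × ℕ)) : List DyckStep :=
  (l.map fun p => List.replicate p.1 DyckStep.U ++ List.replicate p.2 DyckStep.D).flatten

theorem runWord_cons (p : ℕ × ℕ) (l : List (ℕ × ℕ)) :
    runWord (p :: l) = List.replicate p.1 DyckStep.U ++
      (List.replicate p.2 DyckStep.D ++ runWord l) := by
  simp [runWord]

theorem staysNonneg_replicate_U (h a : ℕ) (w : List DyckStep) :
    StaysNonneg h (List.replicate a DyckStep.U ++ w) ↔ StaysNonneg (h + a) w := by
  constructor
  · intro H i
    have := H (a + i)
    simp [List.take_append, List.take_replicate, List.count_replicate] at this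
    omega
  · intro H i
    have := H (i - a)
    simp only [List.take_append, List.take_replicate, List.count_append, List.count_replicate,
      List.length_replicate]
    simp
    rcases le_total a i with h | h
    · rw [min_eq_right h]
      omega
    · rw [Nat.sub_eq_zero_of_le h]
      simp

theorem staysNonneg_replicate_D (h d : ℕ) (w : List DyckStep) :
    StaysNonneg h (List.replicate d DyckStep.D ++ w) ↔ d ≤ h ∧ StaysNonneg (h - d) w := by
  constructor
  · intro H
    have h0 : d ≤ h := by
      have := H d
      simpa [List.take_append, List.take_replicate, List.count_replicate] using this
    refine ⟨h0, fun i => ?_⟩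
    have := H (d + i)
    simp [List.take_append, List.take_replicate, List.count_replicate] at this
    omega
  · rintro ⟨h0, H⟩ i
    have := H (i - d)
    simp only [List.take_append, List.take_replicate, List.count_append, List.count_replicate,
      List.length_replicate]
    simp
    rcases le_total d i with h | h
    · rw [min_eq_right h]
      omega
    · rw [Nat.sub_eq_zero_of_le h]
      simp
      omega

theorem staysNonneg_runWord (l : List (ℕ × ℕ)) (h : ℕ) :
    StaysNonneg h (runWord l) ↔
      ∀ i, ((l.take i).map Prod.snd).sum ≤ h + ((l.take i).map Prod.fst).sum := by
  induction l generalizing h with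
  | nil => simp [runWord, StaysNonneg]
  | cons p l ih =>
    rw [runWord_cons, staysNonneg_replicate_U, staysNonneg_replicate_D, ih]
    constructor
    · rintro ⟨h1, h2⟩ (_ | i)
      · simp
      · have := h2 i
        simp only [List.take_succ_cons, List.map_cons, List.sum_cons]
        omega
    · intro H
      have h1 := H 1
      simp only [List.take_succ_cons, List.map_cons, List.sum_cons, List.take_zero, List.map_nil,
        List.sum_nil] at h1
      refine ⟨by omega, fun i => ?_⟩
      have h2 := H (i + 1)
      simp only [List.take_succ_cons, List.map_cons, List.sum_cons] at h2
      omega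

theorem count_U_runWord (l : List (ℕ × ℕ)) :
    (runWord l).count DyckStep.U = (l.map Prod.fst).sum := by
  induction l with
  | nil => simp [runWord]
  | cons p l ih => simp [runWord_cons, List.count_replicate, ih]

theorem count_D_runWord (l : List (ℕ × ℕ)) :
    (runWord l).count DyckStep.D = (l.map Prod.snd).sum := by
  induction l with
  | nil => simp [runWord]
  | cons p l ih => simp [runWord_cons, List.count_replicate, ih]

theorem replicate_append_cancel {T : Type*} {x : T} {d e : ℕ} {v w : List T}
    (hv : v.head? ≠ some x) (hw : w.head? ≠ some x)
    (h : List.replicate d x ++ v = List.replicate e x ++ w) : d = e ∧ v = w := by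
  induction d generalizing e with
  | zero =>
    cases e with
    | zero => exact ⟨rfl, h⟩
    | succ e => simp at h; simp [h, List.replicate_succ] at hv
  | succ d ih =>
    cases e with
    | zero => simp at h; simp [← h, List.replicate_succ] at hw
    | succ e =>
      simp only [List.replicate_succ, List.cons_append, List.cons.injEq, true_and] at h
      exact (ih h).imp (congrArg _) id

theorem head?_runWord {l : List (ℕ × ℕ)} (hl : ∀ p ∈ l, 0 < p.1) :
    (runWord l).head? ≠ some DyckStep.D := by
  cases l with
  | nil => simp [runWord]
  | cons p l =>
    obtain ⟨a, ha⟩ : ∃ a, p.1 = a + 1 := ⟨p.1 - 1, by have := hl p (by simp); omega⟩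
    simp [runWord_cons, ha, List.replicate_succ]

theorem runWord_injective {l l' : List (ℕ × ℕ)} (hl : ∀ p ∈ l, 0 < p.1)
    (hfst : l.map Prod.fst = l'.map Prod.fst) (h : runWord l = runWord l') : l = l' := by
  induction l generalizing l' with
  | nil => simpa using hfst.symm
  | cons p l ih =>
    cases l' with
    | nil => simp at hfst
    | cons p' l' =>
      simp only [List.map_cons, List.cons.injEq] at hfst
      have hl2 : ∀ q ∈ l, 0 < q.1 := fun q hq => hl q (List.mem_cons_of_mem _ hq)
      have hl2' : ∀ q ∈ l', 0 < q.1 := by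
        have : ∀ x ∈ l.map Prod.fst, 0 < x := by simpa using fun a b h => hl2 (a, b) h
        rw [hfst.2] at this
        simpa using this
      rw [runWord_cons, runWord_cons, hfst.1, List.append_cancel_left_eq] at h
      obtain ⟨h1, h2⟩ := replicate_append_cancel (head?_runWord hl2) (head?_runWord hl2') h
      rw [ih hl2 hfst.2 h2, Prod.ext hfst.1 h1]

/-- The sequences of lengths of the runs of down steps of the Dyck paths with ascent composition `α`. -/
def IsDescentSeq {n : ℕ} (α : Composition n) (δ : Fin α.length → ℕ) : Prop :=
  (∀ i, 0 < δ i) ∧ ∑ i, δ i = n ∧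
    ∀ i, ((List.ofFn δ).take i).sum ≤ α.sizeUpTo i

/-- The runs of the word with ascent composition `α` and descent lengths `δ`. -/
def runs {n : ℕ} (α : Composition n) (δ : Fin α.length → ℕ) : List (ℕ × ℕ) :=
  List.ofFn fun i => (α.blocksFun i, δ i)

theorem map_fst_runs {n : ℕ} (α : Composition n) (δ : Fin α.length → ℕ) :
    (runs α δ).map Prod.fst = α.blocks := by
  rw [runs, List.map_ofFn, ← α.ofFn_blocksFun]
  rfl

theorem map_snd_runs {n : ℕ} (α : Composition n) (δ : Fin α.length → ℕ) :
    (runs α δ).map Prod.snd = List.ofFn δ := by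
  rw [runs, List.map_ofFn]
  rfl

theorem runWord_runs {n : ℕ} (α : Composition n) (δ : Fin α.length → ℕ) :
    runWord (runs α δ) = (List.ofFn fun i : Fin α.length =>
      List.replicate (α.blocksFun i) DyckStep.U ++ List.replicate (δ i) DyckStep.D).flatten := by
  rw [runs, runWord, List.map_ofFn]
  rfl

theorem isDescentSeq_iff {n : ℕ} {α : Composition n} {δ : Fin α.length → ℕ} (hδ : ∀ i, 0 < δ i) :
    IsDescentSeq α δ ↔
      (runWord (runs α δ)).count DyckStep.U = (runWord (runs α δ)).count DyckStep.D ∧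
      StaysNonneg 0 (runWord (runs α δ)) := by
  rw [IsDescentSeq, count_U_runWord, count_D_runWord, staysNonneg_runWord, map_fst_runs,
    map_snd_runs, List.sum_ofFn, α.blocks_sum]
  simp only [hδ, implies_true, true_and, zero_add, List.map_take, map_fst_runs, map_snd_runs,
    Composition.sizeUpTo, eq_comm]

/-- A Dyck path is determined by its ascent composition and the lengths of its runs of down
steps. -/
theorem numDyckPaths_eq_card_descentSeq {n : ℕ} (α : Composition n) :
    numDyckPaths α = Nat.card {δ // IsDescentSeq α δ} := by
  symm
  refine Nat.card_congr (Equiv.ofBijective (fun δ => ⟨⟨runWord (runs α δ.1),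
    ((isDescentSeq_iff δ.2.1).1 δ.2).1, fun i => by
      simpa using ((isDescentSeq_iff δ.2.1).1 δ.2).2 i⟩, δ.1, δ.2.1, runWord_runs α δ.1⟩) ⟨?_, ?_⟩)
  · rintro ⟨δ, hδ⟩ ⟨δ', hδ'⟩ h
    have h1 : runWord (runs α δ) = runWord (runs α δ') := congrArg (fun D => D.1.toList) h
    have h2 := runWord_injective (fun p hp => α.blocks_pos (by
      rw [← map_fst_runs α δ]; exact List.mem_map_of_mem hp))
      (by rw [map_fst_runs, map_fst_runs]) h1
    have h3 := congrArg (List.map Prod.snd) h2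
    rw [map_snd_runs, map_snd_runs] at h3
    exact Subtype.ext (List.ofFn_injective h3)
  · rintro ⟨⟨w, hUD, hDU⟩, δ, hδ, hw⟩
    simp only [← runWord_runs] at hw
    subst hw
    exact ⟨⟨δ, (isDescentSeq_iff hδ).2 ⟨hUD, fun i => by simpa using hDU i⟩⟩, rfl⟩

/-! ### Dyck paths and sequences of spots -/

theorem sum_take_ofFn_succ {k : ℕ} (δ : Fin k → ℕ) {i : ℕ} (hi : i < k) :
    ((List.ofFn δ).take (i + 1)).sum = ((List.ofFn δ).take i).sum + δ ⟨i, hi⟩ := by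
  rw [List.sum_take_succ _ _ (by simpa using hi), List.getElem_ofFn]

theorem sum_take_ofFn_length {k : ℕ} (δ : Fin k → ℕ) :
    ((List.ofFn δ).take k).sum = ∑ i, δ i := by
  rw [List.take_of_length_le (by simp), List.sum_ofFn]

theorem sizeUpTo_lt {n : ℕ} (α : Composition n) {i : ℕ} (hi : i < α.length) : α.sizeUpTo i < n :=
  (α.sizeUpTo_strict_mono hi).trans_le (α.sizeUpTo_le _)

/-- The partial sums of the lengths of the runs of down steps form a spot sequence, and every spot
sequence arises once. -/
theorem card_descentSeq_eq_card_spotSeq {n : ℕ} (α : Composition n) :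
    Nat.card {δ // IsDescentSeq α δ} = Nat.card (SpotSeq α) := by
  refine Nat.card_congr (Equiv.ofBijective (fun δ => ⟨fun i => ((List.ofFn δ.1).take i).sum, ?_,
    fun i => δ.2.2.2 i⟩) ⟨?_, ?_⟩)
  · intro i j hij
    have h1 : ((List.ofFn δ.1).take i).sum < ((List.ofFn δ.1).take (i + 1)).sum := by
      have := δ.2.1 i
      rw [sum_take_ofFn_succ δ.1 i.2]
      simpa using this
    exact h1.trans_le (List.monotone_sum_take _ (Nat.succ_le_of_lt hij))
  · rintro ⟨δ, hδ⟩ ⟨δ', hδ'⟩ h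
    have key : ∀ i ≤ α.length, ((List.ofFn δ).take i).sum = ((List.ofFn δ').take i).sum := by
      intro i hi
      rcases hi.lt_or_eq with hi | rfl
      · exact congrFun (congrArg Subtype.val h) ⟨i, hi⟩
      · rw [sum_take_ofFn_length, sum_take_ofFn_length, hδ.2.1, hδ'.2.1]
    refine Subtype.ext (funext fun i => ?_)
    have h1 := key (i + 1) i.2
    rw [sum_take_ofFn_succ _ i.2, sum_take_ofFn_succ _ i.2, key i i.2.le] at h1
    exact Nat.add_left_cancel h1
  · rintro ⟨y, hy, hyb⟩
    -- The sequence `y`, continued by its endpoint `n`.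
    set z : ℕ → ℕ := fun i => if h : i < α.length then y ⟨i, h⟩ else n with hz
    have hz0 : z 0 = 0 := by
      rcases Nat.eq_zero_or_pos α.length with h | h
      · simp [hz, h, α.length_eq_zero.1 h]
      · have := hyb ⟨0, h⟩
        simpa [hz, h] using this
    have hzlt : ∀ i < α.length, z i < z (i + 1) := by
      intro i hi
      by_cases hi' : i + 1 < α.length
      · simp only [hz, hi, hi', dif_pos]
        exact hy (Nat.lt_succ_self i)
      · simp only [hz, hi, hi', dif_pos, dif_neg, not_false_eq_true]
        exact (hyb ⟨i, hi⟩).trans_lt (sizeUpTo_lt α hi)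
    have hsum : ∀ i ≤ α.length,
        ((List.ofFn fun i : Fin α.length => z (i + 1) - z i).take i).sum = z i := by
      intro i
      induction i with
      | zero => simp [hz0]
      | succ i ih =>
        intro hi
        have := hzlt i hi
        rw [sum_take_ofFn_succ _ hi, ih (by omega)]
        simp only
        omega
    have htot : ∑ i : Fin α.length, (z (i + 1) - z i) = n := by
      rw [← sum_take_ofFn_length, hsum _ le_rfl]
      simp [hz]
    refine ⟨⟨fun i => z (i + 1) - z i, fun i => Nat.sub_pos_of_lt (hzlt i i.2), htot,
      fun i => ?_⟩, ?_⟩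
    · rcases lt_or_ge i α.length with hi | hi
      · rw [hsum i hi.le]
        simpa [hz, hi] using hyb ⟨i, hi⟩
      · rw [List.take_of_length_le (by simpa using hi), List.sum_ofFn, htot,
          α.sizeUpTo_ofLength_le i hi]
    · refine Subtype.ext (funext fun i => ?_)
      simp only
      rw [hsum i i.2.le]
      simp [hz]

theorem numDyckPaths_eq_card_spotSeq {n : ℕ} (α : Composition n) :
    numDyckPaths α = Nat.card (SpotSeq α) := by
  rw [numDyckPaths_eq_card_descentSeq, card_descentSeq_eq_card_spotSeq]

theorem numDyckPaths_eq {n : ℕ} (α : Composition n) : (numDyckPaths α : ℤ) = dyckDet α := by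
  rw [numDyckPaths_eq_card_spotSeq, card_spotSeq, dyckDet_eq_pathSum]

/-! ### Parking functions -/

/-- `π` contains `σ` if and only if there are values `g 0 < g 1 < ⋯` of `π` whose positions are
ordered as prescribed by `σ`. -/
theorem contains_iff_exists_values {n k : ℕ} (π : Equiv.Perm (Fin n)) (σ : Equiv.Perm (Fin k)) :
    Contains π σ ↔
      ∃ g : Fin k → Fin n, StrictMono g ∧ StrictMono fun a => π.symm (g (σ a)) := by
  constructor
  · rintro ⟨f, hf⟩
    refine ⟨fun b => π (f (σ.symm b)), fun a b hab => (hf _ _).2 (by simpa using hab), ?_⟩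
    simpa using f.strictMono
  · rintro ⟨g, hg, hpos⟩
    exact ⟨OrderEmbedding.ofStrictMono _ hpos, fun a b => by simpa using hg.lt_iff_lt⟩

/-- The position of `x` in `sort w` is its rank for the lexicographic order of the pairs
`(w x, x)`; that is, `(sort w)⁻¹` is the standardization of `w`. -/
theorem sort_symm_lt_iff {n : ℕ} {B : Type*} [LinearOrder B] (w : Fin n → B) (x y : Fin n) :
    (Tuple.sort w).symm x < (Tuple.sort w).symm y ↔ w x < w y ∨ w x = w y ∧ x < y := by
  obtain ⟨h1, h2⟩ := Tuple.eq_sort_iff.1 (rfl : Tuple.sort w = Tuple.sort w)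
  have key : ∀ x y, (Tuple.sort w).symm x < (Tuple.sort w).symm y →
      w x < w y ∨ w x = w y ∧ x < y := by
    intro x y h
    have h3 : w x ≤ w y := by simpa using h1 h.le
    rcases h3.lt_or_eq with h4 | h4
    · exact .inl h4
    · exact .inr ⟨h4, by simpa using h2 _ _ h (by simpa using h4)⟩
  refine ⟨key x y, fun h => ?_⟩
  rcases lt_trichotomy ((Tuple.sort w).symm x) ((Tuple.sort w).symm y) with h' | h' | h'
  · exact h'
  · rw [Equiv.apply_eq_iff_eq] at h'
    simp [h'] at h
  · have := key y x h'
    grind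

theorem sort_symm_lt_iff_of_lt {n : ℕ} {B : Type*} [LinearOrder B] (w : Fin n → B) {x y : Fin n}
    (h : x < y) : (Tuple.sort w).symm x < (Tuple.sort w).symm y ↔ w x ≤ w y := by
  rw [sort_symm_lt_iff]
  simp [h, le_iff_lt_or_eq]

theorem sort_symm_lt_iff_of_gt {n : ℕ} {B : Type*} [LinearOrder B] (w : Fin n → B) {x y : Fin n}
    (h : y < x) : (Tuple.sort w).symm x < (Tuple.sort w).symm y ↔ w x < w y := by
  rw [sort_symm_lt_iff]
  simp [h.le]

theorem strictMono_fin_three {B : Type*} [Preorder B] (h : Fin 3 → B) :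
    StrictMono h ↔ h 0 < h 1 ∧ h 1 < h 2 := by
  rw [Fin.strictMono_iff_lt_succ, Fin.forall_fin_two]
  rfl

theorem contains_three_iff {n : ℕ} {B : Type*} [LinearOrder B] (w : Fin n → B)
    (σ : Equiv.Perm (Fin 3)) :
    Contains (Tuple.sort w) σ ↔ ∃ P Q R : Fin n, P < Q ∧ Q < R ∧
      (Tuple.sort w).symm (![P, Q, R] (σ 0)) < (Tuple.sort w).symm (![P, Q, R] (σ 1)) ∧
      (Tuple.sort w).symm (![P, Q, R] (σ 1)) < (Tuple.sort w).symm (![P, Q, R] (σ 2)) := by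
  rw [contains_iff_exists_values]
  constructor
  · rintro ⟨g, hg, h⟩
    have e : g = ![g 0, g 1, g 2] := by ext i; fin_cases i <;> rfl
    rw [strictMono_fin_three] at hg h
    refine ⟨g 0, g 1, g 2, hg.1, hg.2, ?_⟩
    rw [← e]
    exact h
  · rintro ⟨P, Q, R, hPQ, hQR, h⟩
    exact ⟨![P, Q, R], (strictMono_fin_three _).2 ⟨hPQ, hQR⟩, (strictMono_fin_three _).2 h⟩

theorem triplewise_ofFn {n : ℕ} {B : Type*} (w : Fin n → B) (r : B → B → B → Prop) :
    (List.ofFn w).Triplewise r ↔ ∀ i j k : Fin n, i < j → j < k → r (w i) (w j) (w k) := by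
  rw [List.triplewise_iff_getElem]
  simp only [List.getElem_ofFn, List.length_ofFn]
  exact ⟨fun h i j k hij hjk => h i j k hij hjk k.2,
    fun h i j k hij hjk hk => h ⟨i, by omega⟩ ⟨j, by omega⟩ ⟨k, hk⟩ hij hjk⟩

theorem not_contains_perm132_iff {n : ℕ} {B : Type*} [LinearOrder B] (w : Fin n → B) :
    ¬ Contains (Tuple.sort w) perm132 ↔ Avoids132 (List.ofFn w) := by
  rw [contains_three_iff, Avoids132, triplewise_ofFn]
  push Not
  refine forall₃_congr fun P Q R => forall₂_congr fun hPQ hQR => ?_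
  simp only [show perm132 0 = 0 from rfl, show perm132 1 = 2 from rfl, show perm132 2 = 1 from rfl,
    Matrix.cons_val, sort_symm_lt_iff_of_lt w (hPQ.trans hQR), ← not_lt]
  rw [sort_symm_lt_iff_of_gt w hQR]

theorem not_contains_perm231_iff {n : ℕ} {B : Type*} [LinearOrder B] (w : Fin n → B) :
    ¬ Contains (Tuple.sort w) perm231 ↔ Avoids312 (List.ofFn w) := by
  rw [contains_three_iff, Avoids312, triplewise_ofFn]
  push Not
  refine forall₃_congr fun P Q R => forall₂_congr fun hPQ hQR => ?_
  simp only [show perm231 0 = 1 from rfl, show perm231 1 = 2 from rfl, show perm231 2 = 0 from rfl,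
    Matrix.cons_val, sort_symm_lt_iff_of_lt w hQR, ← not_lt]
  rw [sort_symm_lt_iff_of_gt w (hPQ.trans hQR)]

theorem not_contains_perm213_iff {n : ℕ} {B : Type*} [LinearOrder B] (w : Fin n → B) :
    ¬ Contains (Tuple.sort w) perm213 ↔ Avoids132 (dualWord (List.ofFn w)) := by
  rw [contains_three_iff, Avoids132, dualWord, List.triplewise_map, List.triplewise_reverse,
    triplewise_ofFn]
  push Not
  refine forall₃_congr fun P Q R => forall₂_congr fun hPQ hQR => ?_
  simp only [show perm213 0 = 1 from rfl, show perm213 1 = 0 from rfl, show perm213 2 = 2 from rfl,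
    Matrix.cons_val, sort_symm_lt_iff_of_gt w hPQ,
    OrderDual.toDual_lt_toDual, ← not_lt]
  rw [sort_symm_lt_iff_of_lt w (hPQ.trans hQR), not_lt]
  tauto

theorem not_contains_perm312_iff {n : ℕ} {B : Type*} [LinearOrder B] (w : Fin n → B) :
    ¬ Contains (Tuple.sort w) perm312 ↔ Avoids312 (dualWord (List.ofFn w)) := by
  rw [contains_three_iff, Avoids312, dualWord, List.triplewise_map, List.triplewise_reverse,
    triplewise_ofFn]
  push Not
  refine forall₃_congr fun P Q R => forall₂_congr fun hPQ hQR => ?_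
  simp only [show perm312 0 = 2 from rfl, show perm312 1 = 0 from rfl, show perm312 2 = 1 from rfl,
    Matrix.cons_val, sort_symm_lt_iff_of_gt w (hPQ.trans hQR),
    OrderDual.toDual_lt_toDual, ← not_lt]
  rw [sort_symm_lt_iff_of_lt w hPQ, not_lt]
  tauto

/-- Sorting does not change when the letters are relabelled by an increasing map. -/
theorem sort_eq_sort {n : ℕ} {B B' : Type*} [LinearOrder B] [LinearOrder B'] {p : Fin n → B}
    {w : Fin n → B'} (h : ∀ i j, p i ≤ p j ↔ w i ≤ w j) : Tuple.sort p = Tuple.sort w := by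
  obtain ⟨h1, h2⟩ := Tuple.eq_sort_iff.1 (rfl : Tuple.sort p = Tuple.sort p)
  refine Tuple.eq_sort_iff.2 ⟨fun i j hij => (h _ _).1 (h1 hij), fun i j hij hw => h2 i j hij ?_⟩
  exact le_antisymm ((h _ _).2 hw.le) ((h _ _).2 hw.ge)

theorem card_lt_eq_sizeUpTo {n : ℕ} {α : Composition n} {w : Fin n → Fin α.length}
    (hw : ∀ i, (List.ofFn w).count i = α.blocksFun i) {m : ℕ} (hm : m ≤ α.length) :
    #{x | (w x : ℕ) < m} = α.sizeUpTo m := by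
  have hfib : ∀ i, #{x | w x = i} = α.blocksFun i := by
    intro i
    rw [← hw i, List.ofFn_eq_map, ← Multiset.coe_count, ← Multiset.map_coe, Multiset.count_map]
    simp only [eq_comm (a := i)]
    rfl
  induction m with
  | zero => simp
  | succ m ih =>
    rw [α.sizeUpTo_succ hm, ← ih (by omega)]
    have h2 := hfib ⟨m, hm⟩
    rw [show α.blocks[m] = α.blocksFun ⟨m, hm⟩ from rfl, ← h2, ← card_union_of_disjoint]
    · congr 1
      ext x
      simp [Fin.ext_iff, le_iff_lt_or_eq]
    · refine disjoint_left.2 fun x hx hx' => ?_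
      simp only [mem_filter, mem_univ, true_and, Fin.ext_iff] at hx hx'
      omega

/-- A word of content `α` with its letters replaced by spots `y_1 < ⋯ < y_k` is a parking function
if and only if `y_i ≤ α_1 + ⋯ + α_{i-1}`, spots being numbered from `0`. -/
theorem isParkingFunction_iff {n : ℕ} {α : Composition n} {w : Fin n → Fin α.length}
    (hw : ∀ i, (List.ofFn w).count i = α.blocksFun i) {y : Fin α.length → ℕ} (hy : StrictMono y)
    {p : Fin n → Fin n} (hp : ∀ x, (p x : ℕ) = y (w x)) :
    IsParkingFunction p ↔ ∀ i, y i ≤ α.sizeUpTo i := by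
  have hsort : Tuple.sort p = Tuple.sort w := sort_eq_sort fun i j => by
    rw [Fin.le_def, hp, hp, hy.le_iff_le]
  have hmono := Tuple.monotone_sort w
  have hcard : ∀ (P : Fin α.length → Prop) [DecidablePred P],
      #{x | P ((w ∘ Tuple.sort w) x)} = #{x | P (w x)} := fun P _ =>
    card_bij (fun x _ => Tuple.sort w x) (by simp) (by simp)
      fun x hx => ⟨(Tuple.sort w).symm x, by simpa using hx, by simp⟩
  have hlt : ∀ (j : Fin n) (a : Fin α.length), (j : ℕ) < α.sizeUpTo a ↔ w (Tuple.sort w j) < a := by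
    intro j a
    have h := Tuple.lt_card_lt_iff_apply_lt_of_monotone (j := j) (a := a) hmono
    rwa [hcard (· < a), show #{x | w x < a} = α.sizeUpTo a from card_lt_eq_sizeUpTo hw a.2.le] at h
  have hle : ∀ (j : Fin n) (a : Fin α.length),
      (j : ℕ) < α.sizeUpTo (a + 1) ↔ w (Tuple.sort w j) ≤ a := by
    intro j a
    have h := Tuple.lt_card_le_iff_apply_le_of_monotone (j := j) (a := a) hmono
    rwa [hcard (· ≤ a), show #{x | w x ≤ a} = α.sizeUpTo (a + 1) by
      rw [← card_lt_eq_sizeUpTo hw (m := a + 1) a.2]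
      exact congrArg Finset.card (filter_congr fun x _ => by rw [Fin.le_def, Nat.lt_succ_iff])] at h
  constructor
  · intro h i
    have h1 := h ⟨α.sizeUpTo i, sizeUpTo_lt α i.2⟩
    rw [Fin.le_def, hp, hsort] at h1
    have h2 : w (Tuple.sort w ⟨α.sizeUpTo i, sizeUpTo_lt α i.2⟩) = i :=
      le_antisymm ((hle _ _).1 (α.sizeUpTo_strict_mono i.2))
        (not_lt.1 ((hlt _ _).not.1 (lt_irrefl _)))
    rwa [h2] at h1
  · intro h i
    rw [Fin.le_def, hp, hsort]
    exact (h _).trans (not_lt.1 ((hlt _ _).not.2 (lt_irrefl _)))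

theorem count_ofFn_eq {n k : ℕ} {y : Fin k → ℕ} (hy : StrictMono y) {w : Fin n → Fin k}
    {p : Fin n → Fin n} (hp : ∀ x, (p x : ℕ) = y (w x)) (i : Fin k) :
    (List.ofFn fun x => (p x : ℕ)).count (y i) = (List.ofFn w).count i := by
  rw [← List.count_map_of_injective _ y hy.injective, List.map_ofFn]
  congr 2
  exact funext hp

/-- The words of content `α` satisfying `N`, as functions on positions. -/
abbrev ContentFuns {n : ℕ} (α : Composition n) (N : List (Fin α.length) → Prop) : Type :=
  {w : Fin n → Fin α.length // (∀ i, (List.ofFn w).count i = α.blocksFun i) ∧ N (List.ofFn w)}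

theorem card_contentFuns {n : ℕ} (α : Composition n) (N : List (Fin α.length) → Prop) :
    Nat.card (ContentFuns α N) = Nat.card (ContentWords α N) := by
  refine Nat.card_congr (Equiv.ofBijective (fun w => ⟨List.ofFn w.1, w.2⟩) ⟨?_, ?_⟩)
  · intro w w' h
    exact Subtype.ext (List.ofFn_injective (congrArg Subtype.val h))
  · rintro ⟨w, hw⟩
    have hlen : w.length = n := by
      have h := congrArg Multiset.card ((count_eq_iff α w).1 hw.1)
      simpa [contentMultiset, α.sum_blocksFun] using h
    have e : List.ofFn (fun i : Fin n => w.get (i.cast hlen.symm)) = w := by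
      apply List.ext_getElem <;> simp [hlen]
    exact ⟨⟨fun i => w.get (i.cast hlen.symm), by rwa [e]⟩, Subtype.ext e⟩

/-- Every function `p` is of the form `y ∘ w`, where `y` increases and the word `w` has the content
of some composition `α`. -/
theorem exists_composition {n : ℕ} (p : Fin n → Fin n) :
    ∃ (α : Composition n) (y : Fin α.length → ℕ) (w : Fin n → Fin α.length), StrictMono y ∧
      (∀ x, (p x : ℕ) = y (w x)) ∧ ∀ i, (List.ofFn w).count i = α.blocksFun i := by
  set L := List.ofFn fun x => (p x : ℕ) with hL
  set S := L.toFinset.sort with hS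
  have hmem : ∀ s, s ∈ S ↔ s ∈ L := by simp [hS]
  have hnodup : S.Nodup := sort_nodup _ _
  let α : Composition n :=
    { blocks := S.map fun s => L.count s
      blocks_pos := by
        intro i hi
        obtain ⟨s, hs, rfl⟩ := List.mem_map.1 hi
        exact List.count_pos_iff.2 ((hmem s).1 hs)
      blocks_sum := by
        rw [← List.sum_toFinset _ hnodup, hS, sort_toFinset, List.sum_toFinset_count_eq_length, hL,
          List.length_ofFn] }
  have hlen : α.length = S.length := List.length_map _
  set y : Fin α.length → ℕ := fun i => S.get (i.cast hlen) with hy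
  have hmono : StrictMono y := fun i j hij => (sortedLT_sort L.toFinset).strictMono_get hij
  have hex : ∀ x, ∃ i, (p x : ℕ) = y i := by
    intro x
    have : (p x : ℕ) ∈ S := (hmem _).2 (by simp [hL])
    obtain ⟨i, hi⟩ := List.mem_iff_get.1 this
    exact ⟨i.cast hlen.symm, by simpa [hy] using hi.symm⟩
  choose w hw using hex
  refine ⟨α, y, w, hmono, hw, fun i => ?_⟩
  rw [← count_ofFn_eq hmono hw i]
  simp [Composition.blocksFun, α, hy, hL]

/-- Uniqueness of the composition in `exists_composition`. -/
theorem composition_unique {n : ℕ} {p : Fin n → Fin n} {α α' : Composition n}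
    {y : Fin α.length → ℕ} {y' : Fin α'.length → ℕ} {w : Fin n → Fin α.length}
    {w' : Fin n → Fin α'.length} (hy : StrictMono y) (hy' : StrictMono y')
    (hp : ∀ x, (p x : ℕ) = y (w x)) (hp' : ∀ x, (p x : ℕ) = y' (w' x))
    (hw : ∀ i, (List.ofFn w).count i = α.blocksFun i)
    (hw' : ∀ i, (List.ofFn w').count i = α'.blocksFun i) :
    List.ofFn y = List.ofFn y' ∧ α = α' := by
  have hmem : ∀ {β : Composition n} {z : Fin β.length → ℕ} {v : Fin n → Fin β.length},
      (∀ x, (p x : ℕ) = z (v x)) → (∀ i, (List.ofFn v).count i = β.blocksFun i) →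
      ∀ s, s ∈ List.ofFn z ↔ ∃ x, (p x : ℕ) = s := by
    intro β z v hz hv s
    rw [List.mem_ofFn']
    constructor
    · rintro ⟨i, rfl⟩
      have : i ∈ List.ofFn v := List.count_pos_iff.1 ((hv i).symm ▸ β.one_le_blocksFun i)
      obtain ⟨x, rfl⟩ := (List.mem_ofFn' _ _).1 this
      exact ⟨x, hz x⟩
    · rintro ⟨x, rfl⟩
      exact ⟨v x, (hz x).symm⟩
  have hblocks : ∀ {β : Composition n} {z : Fin β.length → ℕ} {v : Fin n → Fin β.length},
      StrictMono z → (∀ x, (p x : ℕ) = z (v x)) → (∀ i, (List.ofFn v).count i = β.blocksFun i) →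
      β.blocks = (List.ofFn z).map fun s => (List.ofFn fun x => (p x : ℕ)).count s := by
    intro β z v hz hpz hv
    rw [← β.ofFn_blocksFun, List.map_ofFn]
    congr 1
    funext i
    rw [Function.comp_apply, count_ofFn_eq hz hpz, hv]
  have e : List.ofFn y = List.ofFn y' :=
    List.Pairwise.eq_of_mem_iff (List.pairwise_ofFn.2 fun i j h => hy h)
      (List.pairwise_ofFn.2 fun i j h => hy' h) fun s => by rw [hmem hp hw, hmem hp' hw']
  exact ⟨e, Composition.ext (by rw [hblocks hy hp hw, hblocks hy' hp' hw', e])⟩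

/-- The decomposition `p = y ∘ w` of parking functions. Since `y` is increasing, `labelPerm p` depends
on `w` only. -/
theorem pf_eq_sum {n k : ℕ} (σ : Equiv.Perm (Fin k))
    (N : ∀ α : Composition n, List (Fin α.length) → Prop)
    (hN : ∀ (α : Composition n) (w : Fin n → Fin α.length),
      ¬ Contains (Tuple.sort w) σ ↔ N α (List.ofFn w)) :
    pf n σ = ∑ α : Composition n, Nat.card (SpotSeq α) * Nat.card (ContentWords α (N α)) := by
  have hsort : ∀ {α : Composition n} {y : Fin α.length → ℕ} {w : Fin n → Fin α.length}
      {p : Fin n → Fin n}, StrictMono y → (∀ x, (p x : ℕ) = y (w x)) →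
      labelPerm p = Tuple.sort w := fun hy hp => sort_eq_sort fun i j => by
    rw [Fin.le_def, hp, hp, hy.le_iff_le]
  have hspot : ∀ α : Composition n, Finite (SpotSeq α) := fun α =>
    Finite.of_injective (β := Fin α.length → Fin n)
      (fun y i => ⟨y.1 i, (y.2.2 i).trans_lt (sizeUpTo_lt α i.2)⟩) fun y y' h =>
        Subtype.ext (funext fun i => by simpa using congrFun h i)
  simp only [← card_contentFuns, ← Nat.card_prod]
  rw [← Nat.card_sigma]
  symm
  refine Nat.card_congr (Equiv.ofBijective (fun t => ⟨fun x => ⟨t.2.1.1 (t.2.2.1 x),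
    (t.2.1.2.2 _).trans_lt (sizeUpTo_lt t.1 (t.2.2.1 x).2)⟩,
    (isParkingFunction_iff t.2.2.2.1 t.2.1.2.1 fun _ => rfl).2 t.2.1.2.2, ?_⟩) ⟨?_, ?_⟩)
  · rw [hsort t.2.1.2.1 fun _ => rfl]
    exact (hN _ _).2 t.2.2.2.2
  · rintro ⟨α, y, w⟩ ⟨α', y', w'⟩ h
    have hp : ∀ x, y.1 (w.1 x) = y'.1 (w'.1 x) := fun x => by
      simpa using congrFun (congrArg Subtype.val h) x
    obtain ⟨e, rfl⟩ := composition_unique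
      (p := fun x => ⟨y.1 (w.1 x), (y.2.2 _).trans_lt (sizeUpTo_lt α (w.1 x).2)⟩)
      y.2.1 y'.2.1 (fun _ => rfl) hp w.2.1 w'.2.1
    obtain rfl : y = y' := Subtype.ext (List.ofFn_injective e)
    obtain rfl : w = w' := Subtype.ext (funext fun x => y.2.1.injective (hp x))
    rfl
  · rintro ⟨p, hpark, hav⟩
    obtain ⟨α, y, w, hy, hp, hw⟩ := exists_composition p
    rw [hsort hy hp, hN] at hav
    exact ⟨⟨α, ⟨y, hy, (isParkingFunction_iff hw hy hp).1 hpark⟩, ⟨w, hw, hav⟩⟩,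
      Subtype.ext (funext fun x => Fin.ext (hp x).symm)⟩

theorem pf_perm132 (n : ℕ) :
    pf n perm132 = ∑ α : Composition n, numDyckPaths α * numSylvesterClasses α := by
  rw [pf_eq_sum _ (fun _ => Avoids132) fun _ => not_contains_perm132_iff]
  simp only [numDyckPaths_eq_card_spotSeq, numSylvesterClasses_eq_card_avoids132]

theorem pf_perm231 (n : ℕ) :
    pf n perm231 = ∑ α : Composition n, numDyckPaths α * numSylvesterClasses α := by
  rw [pf_eq_sum _ (fun _ => Avoids312) fun _ => not_contains_perm231_iff]
  simp only [numDyckPaths_eq_card_spotSeq, numSylvesterClasses_eq_card_avoids312]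

theorem pf_perm213 (n : ℕ) :
    pf n perm213 = ∑ α : Composition n, numDyckPaths α * numSharpSylvesterClasses α := by
  rw [pf_eq_sum _ (fun _ w => Avoids132 (dualWord w)) fun _ => not_contains_perm213_iff]
  simp only [numDyckPaths_eq_card_spotSeq, numSharpSylvesterClasses_eq_card_avoids132]

theorem pf_perm312 (n : ℕ) :
    pf n perm312 = ∑ α : Composition n, numDyckPaths α * numSharpSylvesterClasses α := by
  rw [pf_eq_sum _ (fun _ w => Avoids312 (dualWord w)) fun _ => not_contains_perm312_iff]
  simp only [numDyckPaths_eq_card_spotSeq, numSharpSylvesterClasses_eq_card_avoids312]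

end ParkingPattern

open ParkingPattern in
theorem theorem4p3 (n : ℕ) :
    (pf n perm132 = pf n perm231 ∧
      (pf n perm132 : ℤ) = ∑ α : Composition n, dyckDet α * sylvesterDet α) ∧
    (pf n perm213 = pf n perm312 ∧
      (pf n perm213 : ℤ) = ∑ α : Composition n, dyckDet α * sharpSylvesterDet α) ∧
    ∀ α : Composition n,
      (numDyckPaths α : ℤ) = dyckDet α ∧
      (numSylvesterClasses α : ℤ) = sylvesterDet α ∧
      (numSharpSylvesterClasses α : ℤ) = sharpSylvesterDet α := by
  refine ⟨⟨by rw [pf_perm132, pf_perm231], ?_⟩, ⟨by rw [pf_perm213, pf_perm312], ?_⟩, fun α =>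
    ⟨numDyckPaths_eq α, numSylvesterClasses_eq α, numSharpSylvesterClasses_eq α⟩⟩
  · rw [pf_perm132]
    push_cast
    simp only [numDyckPaths_eq, numSylvesterClasses_eq]
  · rw [pf_perm213]
    push_cast
    simp only [numDyckPaths_eq, numSharpSylvesterClasses_eq]
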